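/- Let $X_1$, $X_2$ be non-empty complex projective schemes, let $L_1$, $L_2$ be line bundles on $X_1$, $X_2$ respectively, and put $L_1\boxtimes L_2:=p_1^*L_1\otimes p_2^*L_2$ on $X_1\times X_2$ (the product over $\mathbb{C}$), where $p_1,p_2$ are the two projections. For an integer $k\ge 0$, a line bundle $L$ on a complex projective scheme $X$ is called $k$-very ample if for every $0$-dimensional closed subscheme $Z\subset X$ of length $h^0(\mathcal{O}_Z)=k+1$ the restriction map $\Gamma(X,L)\to\Gamma(Z,L|_Z)$ is onto. Then: 1. If $L_1$ is $k_1$-very ample and $L_2$ is $k_2$-very ample for integers $k_1,k_2\ge 0$, then $L_1\boxtimes L_2$ is $\min\{k_1,k_2\}$-very ample on $X_1\times X_2$. 2. Conversely, for every integer $k'\ge 0$, if $L_1\boxtimes L_2$ is $k'$-very ample on $X_1\times X_2$, then both $L_1$ and $L_2$ are $k'$-very ample. -/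

import Mathlib

open AlgebraicGeometry CategoryTheory

noncomputable section

namespace VeryAmpleness

/-- `Spec ℂ`. -/
abbrev SpecC : Scheme.{0} := Spec (CommRingCat.of ℂ)

attribute [local instance] MvPolynomial.gradedAlgebra

/-- Projective `n`-space over `ℂ`, as `Proj ℂ[x₀, …, xₙ]`. -/
abbrev ProjSpace (n : ℕ) : Scheme.{0} :=
  Proj (MvPolynomial.homogeneousSubmodule (Fin (n + 1)) ℂ)

/-- The structure morphism of projective `n`-space to `Spec ℂ`: the canonical morphism to the
spectrum of the degree-zero part of `ℂ[x₀, …, xₙ]`, followed by the morphism induced by the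
inclusion of the constants. -/
def projSpaceToSpec (n : ℕ) : ProjSpace n ⟶ SpecC :=
  Proj.toSpecZero (MvPolynomial.homogeneousSubmodule (Fin (n + 1)) ℂ) ≫
    Spec.map (CommRingCat.ofHom
      (algebraMap ℂ (MvPolynomial.homogeneousSubmodule (Fin (n + 1)) ℂ 0)))

/-- A complex scheme, given by its structure morphism `s : X ⟶ Spec ℂ`, is projective if it admits
a closed immersion over `Spec ℂ` into some complex projective space. -/
def IsProjective {X : Scheme.{0}} (s : X ⟶ SpecC) : Prop :=
  ∃ (n : ℕ) (j : X ⟶ ProjSpace n), IsClosedImmersion j ∧ j ≫ projSpaceToSpec n = s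

/-- A line bundle (invertible sheaf): a sheaf of modules that is locally isomorphic to the
structure sheaf. -/
def IsLineBundle {X : Scheme.{0}} (L : X.Modules) : Prop :=
  ∀ x : X, ∃ U : X.Opens, x ∈ U ∧
    Nonempty (L.restrict U.ι ≅
      (SheafOfModules.unit (U : Scheme.{0}).ringCatSheaf : (U : Scheme.{0}).Modules))

/-- The tensor product `M ⊗ N` over `𝒪_X` of two sheaves of modules: the sheafification of
`U ↦ Γ(M, U) ⊗ Γ(N, U)`, the tensor product being over `Γ(X, U)`. -/
def tensor {X : Scheme.{0}} (M N : X.Modules) : X.Modules :=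
  (PresheafOfModules.sheafification (𝟙 X.ringCatSheaf.obj)).obj
    (PresheafOfModules.Monoidal.tensorObj (R := X.presheaf) M.val N.val)

/-- The external tensor product `p₁^* L₁ ⊗ p₂^* L₂` on the fibre product `X₁ ×_ℂ X₂`. -/
def boxTensor {X₁ X₂ : Scheme.{0}} (s₁ : X₁ ⟶ SpecC) (s₂ : X₂ ⟶ SpecC)
    (L₁ : X₁.Modules) (L₂ : X₂.Modules) : (Limits.pullback s₁ s₂).Modules :=
  tensor ((Scheme.Modules.pullback (Limits.pullback.fst s₁ s₂)).obj L₁)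
    ((Scheme.Modules.pullback (Limits.pullback.snd s₁ s₂)).obj L₂)

/-- `h⁰(𝒪_Z)`: the complex dimension of the global functions on the complex scheme `Z` with
structure morphism `s` (with the convention that it is `0` if the dimension is infinite). For a
zero-dimensional `Z` of finite type over `ℂ`, this is the length of `𝒪_Z`. -/
def hZero {Z : Scheme.{0}} (s : Z ⟶ SpecC) : ℕ :=
  letI : Algebra ℂ Γ(Z, ⊤) :=
    ((Scheme.ΓSpecIso (CommRingCat.of ℂ)).inv ≫ s.appTop).hom.toAlgebra
  Module.finrank ℂ Γ(Z, ⊤)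

/-- The restriction map `Γ(X, L) ⟶ Γ(Z, i^* L)` of global sections along a morphism `i : Z ⟶ X`:
the global sections of the canonical morphism `L ⟶ i_* i^* L`. When `i` is a closed immersion,
`i_* i^* L` is `𝒪_Z(L) = L ⊗ 𝒪_Z`. -/
def restrictionMap {Z X : Scheme.{0}} (i : Z ⟶ X) (L : X.Modules) :
    Γ(L, ⊤) ⟶ Γ((Scheme.Modules.pullback i).obj L, ⊤) :=
  ((Scheme.Modules.pullbackPushforwardAdjunction i).unit.app L).app ⊤

/-- `L` is `k`-very ample on the complex scheme `X` (with structure morphism `s`) if for every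
zero-dimensional closed subscheme `Z` of `X` of length `k + 1`, the restriction map
`Γ(X, L) ⟶ Γ(Z, L|_Z)` is onto. -/
def IsVeryAmpleOfOrder {X : Scheme.{0}} (s : X ⟶ SpecC) (k : ℕ) (L : X.Modules) : Prop :=
  ∀ (Z : Scheme.{0}) (i : Z ⟶ X), IsClosedImmersion i →
    topologicalKrullDim Z = 0 → hZero (i ≫ s) = k + 1 →
      Function.Surjective (restrictionMap i L)

end VeryAmpleness

end

noncomputable section

namespace VeryAmpleness

open TopologicalSpace TensorProduct

/-! ### Sections and free generators of sheaves of modules -/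

variable {X Y Z W : Scheme.{0}}

/-! Direct half. Let `Z` be a finite subscheme of the product of length `min k₁ k₂ + 1`, and let
`Zᵢ` be its scheme-theoretic image in `Xᵢ`. Since `𝒪(Zᵢ)` embeds in `𝒪(Z)`, the length of `Zᵢ` is at
most `kᵢ + 1`. Very ampleness lifts sections from subschemes of length exactly `kᵢ + 1`; shorter
ones are enlarged by rational points (`IsVeryAmpleOfOrder.restrictionMap_surjective`). Hence `Lᵢ`
restricted to `Zᵢ` is free on the image of a global section `tᵢ`, and every multiple of that
generator lifts (`IsVeryAmpleOfOrder.exists_generator_image`). As `Z` is closed in the affine scheme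
`Z₁ × Z₂`, every function on `Z` is a sum of products `a₁a₂` of functions pulled back from the `Zᵢ`.
If `rᵢ` lifts `aᵢtᵢ`, then `r₁ ⊗ r₂` restricts to `a₁a₂` times the generator `t₁ ⊗ t₂` on `Z`.

Converse half. A rational point of one factor gives a section `σ` of the projection to the other,
and `σ` is a closed immersion. The sheaf from the first factor is trivial near the point, so `σ^*(L₁
⊠ L₂)` is the remaining `Lᵢ`, and lifting along `i ≫ σ` gives lifting along `i`.

Sheaves are handled throughout by local generators: pullback and tensor product preserve them
(`IsGenerator.sec`, `IsGenerator.tmul`), and this replaces explicit isomorphisms. -/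

/-- Restriction of sections of a sheaf of modules to a smaller open subset. -/
def res (M : X.Modules) {U V : X.Opens} (h : V ≤ U) : Γ(M, U) →+ Γ(M, V) :=
  (M.presheaf.map (homOfLE h).op).hom

lemma res_res (M : X.Modules) {U V W : X.Opens} (h : V ≤ U) (h' : W ≤ V) (s : Γ(M, U)) :
    res M h' (res M h s) = res M (h'.trans h) s := by
  change (M.presheaf.map _ ≫ M.presheaf.map _).hom s = _
  rw [← Functor.map_comp]
  rfl

lemma res_self (M : X.Modules) {U : X.Opens} (h : U ≤ U) (s : Γ(M, U)) : res M h s = s := by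
  change (M.presheaf.map (𝟙 _)).hom s = s
  rw [M.presheaf.map_id]; rfl

lemma res_smul (M : X.Modules) {U V : X.Opens} (h : V ≤ U) (a : Γ(X, U)) (s : Γ(M, U)) :
    res M h (a • s) = X.presheaf.map (homOfLE h).op a • res M h s :=
  M.map_smul _ _ _

/-- `s` freely generates the sheaf of modules `M` over the open subset `U`. -/
def IsGenerator (M : X.Modules) (U : X.Opens) (s : Γ(M, U)) : Prop :=
  ∀ (V : X.Opens) (h : V ≤ U), Function.Bijective fun a : Γ(X, V) ↦ a • res M h s

/-- `M` is locally freely generated by one section. -/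
def HasLocalGenerators (M : X.Modules) : Prop :=
  ∀ x : X, ∃ U : X.Opens, x ∈ U ∧ ∃ s : Γ(M, U), IsGenerator M U s

lemma IsGenerator.res {M : X.Modules} {U V : X.Opens} {s : Γ(M, U)} (hs : IsGenerator M U s)
    (h : V ≤ U) : IsGenerator M V (res M h s) := fun W hW ↦ by
  simpa only [res_res] using hs W (hW.trans h)

lemma app_res {M N : X.Modules} (φ : M ⟶ N) {U V : X.Opens} (h : V ≤ U) (s : Γ(M, U)) :
    φ.app V (res M h s) = res N h (φ.app U s) :=
  congr($(φ.mapPresheaf.naturality (homOfLE h).op) s)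

lemma app_bijective {M N : X.Modules} (φ : M ⟶ N) [IsIso φ] (U : X.Opens) :
    Function.Bijective (φ.app U) :=
  (ConcreteCategory.isIso_iff_bijective _).mp inferInstance

lemma IsGenerator.map {M N : X.Modules} {U : X.Opens} {s : Γ(M, U)} (hs : IsGenerator M U s)
    (φ : M ⟶ N) [IsIso φ] : IsGenerator N U (φ.app U s) := fun V h ↦ by
  have := (app_bijective φ V).comp (hs V h)
  convert this using 2 with a
  simp [app_res]

lemma IsGenerator.of_map {M N : X.Modules} {U : X.Opens} {s : Γ(M, U)}
    (φ : M ⟶ N) [IsIso φ] (hs : IsGenerator N U (φ.app U s)) : IsGenerator M U s := by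
  have := hs.map (inv φ)
  rwa [← ConcreteCategory.comp_apply, ← Scheme.Modules.Hom.comp_app, IsIso.hom_inv_id] at this

/-- The structure sheaf as a sheaf of modules. -/
abbrev structureModule (X : Scheme.{0}) : X.Modules := SheafOfModules.unit X.ringCatSheaf

/-- The section `1` of the structure sheaf. -/
def oneSection (X : Scheme.{0}) (U : X.Opens) : Γ(structureModule X, U) := (1 : Γ(X, U))

lemma isGenerator_one (X : Scheme.{0}) (U : X.Opens) :
    IsGenerator (structureModule X) U (oneSection X U) := fun V h ↦ by
  have : VeryAmpleness.res (structureModule X) h (oneSection X U) = oneSection X V :=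
    map_one (X.presheaf.map (homOfLE h).op).hom
  rw [this]
  have : (fun a : Γ(X, V) ↦ a • oneSection X V) = 
    (id : Γ(X, V) → Γ(X, V)) := funext fun a ↦ mul_one a
  erw [this]
  exact Function.bijective_id

/-- A section generating `M` induces an isomorphism from the structure sheaf. -/
lemma IsGenerator.exists_iso {M : X.Modules} {s : Γ(M, ⊤)} (hs : IsGenerator M ⊤ s) :
    ∃ φ : structureModule X ⟶ M, IsIso φ ∧ φ.app ⊤ (oneSection X ⊤) = s := by
  let t : M.sections := ⟨fun U ↦ VeryAmpleness.res M (le_top : U.unop ≤ ⊤) s, fun f ↦ 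
    res_res M le_top f.unop.le s⟩
  let φ : structureModule X ⟶ M := (SheafOfModules.unitHomEquiv M).symm t
  refine ⟨φ, Scheme.Modules.Hom.isIso_iff_isIso_app.mpr fun U ↦ ?_, ?_⟩
  · rw [ConcreteCategory.isIso_iff_bijective]
    exact hs U le_top
  · have := SheafOfModules.unitHomEquiv_apply_coe M ((SheafOfModules.unitHomEquiv M).symm t) (.op ⊤)
    rw [Equiv.apply_symm_apply] at this
    exact this.symm.trans (res_self M _ s)

/-! ### Pullback of sections and of generators -/

/-- The pullback `f^* L` of a sheaf of modules. -/
abbrev pull (f : Z ⟶ X) (L : X.Modules) : Z.Modules := (Scheme.Modules.pullback f).obj L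

/-- The pullback of sections along `f`. -/
def sec (f : Z ⟶ X) (L : X.Modules) (U : X.Opens) : Γ(L, U) →+ Γ(pull f L, f ⁻¹ᵁ U) :=
  (((Scheme.Modules.pullbackPushforwardAdjunction f).unit.app L).app U).hom

lemma sec_smul (f : Z ⟶ X) (L : X.Modules) (U : X.Opens) (a : Γ(X, U)) (s : Γ(L, U)) :
    sec f L U (a • s) = f.app U a • sec f L U s :=
  Scheme.Modules.Hom.app_smul ((Scheme.Modules.pullbackPushforwardAdjunction f).unit.app L) a s

lemma sec_res (f : Z ⟶ X) (L : X.Modules) {U V : X.Opens} (h : V ≤ U) (s : Γ(L, U)) :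
    sec f L V (res L h s) = res (pull f L) (f.preimage_mono h) (sec f L U s) :=
  app_res ((Scheme.Modules.pullbackPushforwardAdjunction f).unit.app L) h s

lemma sec_map (f : Z ⟶ X) {L M : X.Modules} (φ : L ⟶ M) (U : X.Opens) (s : Γ(L, U)) :
    ((Scheme.Modules.pullback f).map φ).app (f ⁻¹ᵁ U) (sec f L U s) = sec f M U (φ.app U s) := by
  have := (Scheme.Modules.pullbackPushforwardAdjunction f).unit.naturality φ
  exact congr(($this).app U s).symm

lemma sec_comp (f : Z ⟶ X) (g : X ⟶ Y) (L : Y.Modules) (U : Y.Opens) (s : Γ(L, U)) :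
    ((Scheme.Modules.pullbackComp f g).hom.app L).app (f ⁻¹ᵁ g ⁻¹ᵁ U)
      (sec f (pull g L) (g ⁻¹ᵁ U) (sec g L U s)) = sec (f ≫ g) L U s := by
  have := unit_conjugateEquiv ((Scheme.Modules.pullbackPushforwardAdjunction g).comp
    (Scheme.Modules.pullbackPushforwardAdjunction f))
    (Scheme.Modules.pullbackPushforwardAdjunction (f ≫ g)) (Scheme.Modules.pullbackComp f g).inv L
  rw [Scheme.Modules.conjugateEquiv_pullbackComp_inv] at this
  have h1 : sec f (pull g L) (g ⁻¹ᵁ U) (sec g L U s) =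
    ((Scheme.Modules.pullbackComp f g).inv.app L).app (f ⁻¹ᵁ g ⁻¹ᵁ U) (sec (f ≫ g) L U s) :=
    congr(($this).app U s)
  rw [h1]
  exact congr(($((Scheme.Modules.pullbackComp f g).inv_hom_id_app L)).app (f ⁻¹ᵁ g ⁻¹ᵁ U)
    (sec (f ≫ g) L U s))

/-- Every open set of `Z` lies in the preimage of `⊤`, and all objects of the comma category map to
that one. Finality is what makes the comparison `f^* 𝒪_X ⟶ 𝒪_Z` an isomorphism. -/
lemma final_opensMap (f : Z ⟶ X) : (Opens.map f.base).Final where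
  out d := by
    let T : StructuredArrow d (Opens.map f.base) :=
      StructuredArrow.mk (Y := ⊤) (homOfLE (le_top : d ≤ ⊤))
    have : Nonempty (StructuredArrow d (Opens.map f.base)) := ⟨T⟩
    have h (j : StructuredArrow d (Opens.map f.base)) : Zigzag j T :=
      .of_hom (StructuredArrow.homMk (homOfLE le_top) (Subsingleton.elim _ _))
    exact zigzag_isConnected fun a b ↦ (h a).trans (h b).symm

lemma sec_one (f : Z ⟶ X) :
    IsGenerator (pull f (structureModule X)) ⊤ (sec f (structureModule X) ⊤ (oneSection X ⊤)) := by
  have : (SheafOfModules.pushforward f.toRingCatSheafHom).IsRightAdjoint :=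
    (Scheme.Modules.pullbackPushforwardAdjunction f).isRightAdjoint
  have := final_opensMap f
  let φ : pull f (structureModule X) ⟶ structureModule Z :=
    SheafOfModules.pullbackObjUnitToUnit f.toRingCatSheafHom
  have : IsIso φ := SheafOfModules.instIsIsoPullbackObjUnitToUnitOfFinal f.toRingCatSheafHom
  refine IsGenerator.of_map φ ?_
  have h := SheafOfModules.pullbackPushforwardAdjunction_homEquiv_pullbackObjUnitToUnit
    f.toRingCatSheafHom
  rw [Adjunction.homEquiv_unit] at h
  have h1 : φ.app ⊤ (sec f (structureModule X) ⊤ (oneSection X ⊤)) = oneSection Z ⊤ :=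
    Eq.trans congr(($h).val.app (.op ⊤) (1 : Γ(X, ⊤))) (map_one f.appTop.hom)
  rw [h1]
  exact isGenerator_one Z ⊤

lemma IsGenerator.sec_top {L : X.Modules} {s : Γ(L, ⊤)} (hs : IsGenerator L ⊤ s) (f : Z ⟶ X) :
    IsGenerator (pull f L) ⊤ (sec f L ⊤ s) := by
  obtain ⟨φ, hφ, rfl⟩ := hs.exists_iso
  rw [← sec_map]
  exact (sec_one f).map _

lemma IsGenerator.sec_of_eq_top {L : X.Modules} {U : X.Opens} (hU : U = ⊤) {s : Γ(L, U)}
    (hs : IsGenerator L U s) (f : Z ⟶ X) : IsGenerator (pull f L) (f ⁻¹ᵁ U) (sec f L U s) := by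
  subst hU
  exact hs.sec_top f

/-- Restriction to an open subscheme agrees with the pullback along the inclusion. -/
lemma restrictFunctorIsoPullback_app (f : Z ⟶ X) [IsOpenImmersion f] (L : X.Modules) (U : X.Opens)
    (s : Γ(L, U)) : ((Scheme.Modules.restrictFunctorIsoPullback f).hom.app L).app (f ⁻¹ᵁ U)
      (res L (f.image_preimage_le U) s : Γ(L, f ''ᵁ f ⁻¹ᵁ U)) = sec f L U s := by
  have := Adjunction.unit_leftAdjointUniq_hom_app (Scheme.Modules.restrictAdjunction f)
    (Scheme.Modules.pullbackPushforwardAdjunction f) L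
  exact congr(($this).app U s)

/-- The sections are the same on both sides; only the scalars change, by the ring isomorphism
`f.appIso`. -/
lemma isGenerator_restrict_iff {L : X.Modules} (f : Z ⟶ X) [IsOpenImmersion f] (W : Z.Opens)
    (s : Γ(L, f ''ᵁ W)) :
    IsGenerator (L.restrict f) W (s : Γ(L.restrict f, W)) ↔ IsGenerator L (f ''ᵁ W) s := by
  have h2 (V : Z.Opens) : Function.Bijective (f.appIso V).inv :=
    (ConcreteCategory.isIso_iff_bijective _).mp inferInstance
  constructor
  · intro h V hV
    obtain ⟨V, rfl⟩ : ∃ W : Z.Opens, f ''ᵁ W = V := ⟨f ⁻¹ᵁ V, by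
      rw [Scheme.Hom.image_preimage_eq_opensRange_inf, inf_eq_right]
      exact hV.trans (f.image_le_opensRange W)⟩
    exact Iff.mp (Function.Bijective.of_comp_iff _ (h2 V)) (h V ((f.image_le_image_iff _ _).mp hV))
  · intro h V hV
    exact (h _ (f.image_mono hV)).comp (h2 V)

lemma HasLocalGenerators_of_isLineBundle {L : X.Modules} (hL : IsLineBundle L) :
    HasLocalGenerators L := fun x ↦ by
  obtain ⟨U, hx, ⟨e⟩⟩ := hL x
  have := (isGenerator_one U ⊤).map e.inv
  exact ⟨U.ι ''ᵁ ⊤, by simpa using hx, e.inv.app ⊤ (oneSection U ⊤),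
    (isGenerator_restrict_iff U.ι ⊤ _).mp this⟩

lemma IsGenerator.restrict {L : X.Modules} {U : X.Opens} {s : Γ(L, U)} (hs : IsGenerator L U s)
    (f : Z ⟶ X) [IsOpenImmersion f] :
    IsGenerator (L.restrict f) (f ⁻¹ᵁ U) 
      (VeryAmpleness.res L (f.image_preimage_le U) s : Γ(L, f ''ᵁ f ⁻¹ᵁ U)) :=
  (isGenerator_restrict_iff f _ _).mpr (hs.res _)

lemma IsGenerator.of_restrict {L : X.Modules} {U : X.Opens} {s : Γ(L, U)} 
    (f : Z ⟶ X) [IsOpenImmersion f] (hU : U ≤ f.opensRange)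
    (hs : IsGenerator (L.restrict f) (f ⁻¹ᵁ U) 
      (VeryAmpleness.res L (f.image_preimage_le U) s : Γ(L, f ''ᵁ f ⁻¹ᵁ U))) :
    IsGenerator L U s := by
  have := (isGenerator_restrict_iff f _ _).mp hs
  have h : U ≤ f ''ᵁ f ⁻¹ᵁ U := by
    rw [Scheme.Hom.image_preimage_eq_opensRange_inf]; exact le_inf hU le_rfl
  simpa [res_res, res_self] using this.res h

lemma IsGenerator.of_sec {L : X.Modules} {U : X.Opens} {s : Γ(L, U)}
    (f : Z ⟶ X) [IsOpenImmersion f] (hU : U ≤ f.opensRange)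
    (hs : IsGenerator (pull f L) (f ⁻¹ᵁ U) (sec f L U s)) : IsGenerator L U s := by
  rw [← restrictFunctorIsoPullback_app] at hs
  exact of_restrict f hU (hs.of_map _)

/-- Over `U` itself the generator is global, hence comes from an isomorphism with the structure
sheaf, and pulls back along `f ∣_U`. The square formed by `f ∣_U`, `f` and the two open inclusions
transfers this to `f`. -/
lemma IsGenerator.sec {L : X.Modules} {U : X.Opens} {s : Γ(L, U)} (hs : IsGenerator L U s)
    (f : Z ⟶ X) : IsGenerator (pull f L) (f ⁻¹ᵁ U) (sec f L U s) := by
  refine of_sec (f ⁻¹ᵁ U).ι (by simp) (of_map ((Scheme.Modules.pullbackComp _ _).hom.app _) ?_)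
  have h1 := hs.restrict U.ι
  have h2 := h1.map ((Scheme.Modules.restrictFunctorIsoPullback U.ι).hom.app L)
  rw [restrictFunctorIsoPullback_app] at h2
  have h3 := (h2.sec_of_eq_top (by simp) (f ∣_ U)).map ((Scheme.Modules.pullbackComp _ _).hom.app _)
  have := sec_comp (f ∣_ U) U.ι L U s
  erw [this] at h3
  have := sec_comp (f ⁻¹ᵁ U).ι f L U s
  erw [this]
  have key : ∀ (g g' : (f ⁻¹ᵁ U : Scheme) ⟶ X) (h : g = g'),
    IsGenerator (pull g L) (g ⁻¹ᵁ U) (VeryAmpleness.sec g L U s) → 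
    IsGenerator (pull g' L) (g' ⁻¹ᵁ U) (VeryAmpleness.sec g' L U s) := by
    rintro g g' rfl h; exact h
  exact key _ _ (morphismRestrict_ι f U) h3

lemma HasLocalGenerators.pull {L : X.Modules} (hL : HasLocalGenerators L) (f : Z ⟶ X) :
    HasLocalGenerators (pull f L) := fun z ↦ by
  obtain ⟨U, hU, s, hs⟩ := hL (f z)
  exact ⟨f ⁻¹ᵁ U, hU, _, hs.sec f⟩

/-- Equal morphisms give pullbacks of different types; the isomorphism carries the transport and is
compatible with pulled-back sections. -/
lemma sec_congr {f g : Z ⟶ X} (h : f = g) (L : X.Modules) :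
    ∃ φ : pull f L ⟶ pull g L, IsIso φ ∧
      ∀ (U : X.Opens) (s : Γ(L, U)), φ.app (f ⁻¹ᵁ U) (sec f L U s) =
        res (pull g L) (h ▸ le_rfl) (sec g L U s) := by
  subst h
  exact ⟨𝟙 _, inferInstance, fun U s ↦ (res_self _ _ _).symm⟩

/-! ### Gluing, and the local nature of generators -/

lemma eq_of_locally_eq (M : X.Modules) {U : X.Opens} {s t : Γ(M, U)}
    (h : ∀ x ∈ U, ∃ (V : X.Opens) (hV : V ≤ U), x ∈ V ∧ res M hV s = res M hV t) : s = t := by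
  choose V hV hx h using h
  refine TopCat.Sheaf.eq_of_locally_eq' ⟨M.presheaf, M.isSheaf⟩ (fun x : U ↦ V x x.2) U
    (fun x ↦ homOfLE (hV x x.2)) ?_ s t fun x ↦ h x x.2
  exact fun x hx' ↦ Opens.mem_iSup.mpr ⟨⟨x, hx'⟩, hx x hx'⟩

lemma exists_glue (M : X.Modules) {ι : Type} (V : ι → X.Opens) (U : X.Opens) (hV : ∀ i, V i ≤ U)
    (hU : U ≤ ⨆ i, V i) (s : ∀ i, Γ(M, V i))
    (h : ∀ i j, res M (inf_le_left : V i ⊓ V j ≤ V i) (s i) =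
      res M (inf_le_right : V i ⊓ V j ≤ V j) (s j)) :
    ∃ t : Γ(M, U), ∀ i, res M (hV i) t = s i := by
  obtain ⟨t, ht, -⟩ := TopCat.Sheaf.existsUnique_gluing' ⟨M.presheaf, M.isSheaf⟩ V U
    (fun i ↦ homOfLE (hV i)) hU s h
  exact ⟨t, ht⟩

lemma IsGenerator.of_locally {M : X.Modules} {U : X.Opens} {s : Γ(M, U)}
    (h : ∀ x ∈ U, ∃ (V : X.Opens) (hV : V ≤ U), x ∈ V ∧ IsGenerator M V (VeryAmpleness.res M hV s)) :
    IsGenerator M U s := by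
  intro W hW
  have h' : ∀ x ∈ W, ∃ (V : X.Opens) (hV : V ≤ W), x ∈ V ∧
      IsGenerator M V (VeryAmpleness.res M (hV.trans hW) s) := fun x hx ↦ by
    obtain ⟨V, hV, hxV, hg⟩ := h x (hW hx)
    refine ⟨V ⊓ W, inf_le_right, ⟨hxV, hx⟩, ?_⟩
    simpa only [res_res] using hg.res (inf_le_left : V ⊓ W ≤ V)
  constructor
  · intro a b hab
    choose V hV hx hg using h'
    refine X.IsSheaf.section_ext fun x hxW ↦ ⟨V x hxW, hV x hxW, hx x hxW, ?_⟩
    apply (hg x hxW _ le_rfl).1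
    have := congr(VeryAmpleness.res M (hV x hxW) $hab)
    simpa only [res_smul, res_res] using this
  · intro m
    choose V hV hx hg using h'
    choose a ha using fun x : W ↦ (hg x x.2 _ le_rfl).2 (VeryAmpleness.res M (hV x x.2) m)
    simp only [res_res] at ha
    -- The local coefficients glue because a coefficient with respect to a generator is unique, so
    -- they agree on overlaps.
    obtain ⟨b, hb⟩ : ∃ b : Γ(X, W), ∀ x : W, X.presheaf.map (homOfLE (hV x x.2)).op b = a x := by
      obtain ⟨b, hb, -⟩ := TopCat.Sheaf.existsUnique_gluing' X.sheaf (fun x : W ↦ V x x.2) W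
        (fun x ↦ homOfLE (hV x x.2)) (fun x hx' ↦ Opens.mem_iSup.mpr ⟨⟨x, hx'⟩, hx x hx'⟩) a (by
          intro x y
          apply (hg x x.2 _ inf_le_left).1
          have h1 := congr(VeryAmpleness.res M (inf_le_left : V x x.2 ⊓ V y y.2 ≤ V x x.2) $(ha x))
          have h2 := congr(VeryAmpleness.res M (inf_le_right : V x x.2 ⊓ V y y.2 ≤ V y y.2) $(ha y))
          simp only [res_smul, res_res] at h1 h2 ⊢
          exact h1.trans h2.symm)
      exact ⟨b, hb⟩
    refine ⟨b, eq_of_locally_eq M fun x hxW ↦ ⟨V x hxW, hV x hxW, hx x hxW, ?_⟩⟩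
    simp only [res_smul, res_res]
    rw [← ha ⟨x, hxW⟩, ← hb ⟨x, hxW⟩]

lemma IsGenerator.unit_smul {M : X.Modules} {U : X.Opens} {s : Γ(M, U)} (hs : IsGenerator M U s)
    {a : Γ(X, U)} (ha : IsUnit a) : IsGenerator M U (a • s) := fun V hV ↦ by
  have h1 : IsUnit (X.presheaf.map (homOfLE hV).op a) := ha.map (X.presheaf.map (homOfLE hV).op).hom
  have := (hs V hV).comp (h1.unit.mulRight_bijective)
  convert this using 2 with b
  simp [res_smul, mul_smul]

lemma IsGenerator.exists_smul {M : X.Modules} {U : X.Opens} {s : Γ(M, U)} (hs : IsGenerator M U s)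
    (t : Γ(M, U)) : ∃ a : Γ(X, U), a • s = t := by
  obtain ⟨a, ha⟩ := (hs U le_rfl).2 t
  exact ⟨a, by simpa [res_self] using ha⟩

lemma IsGenerator.smul_inj {M : X.Modules} {U : X.Opens} {s : Γ(M, U)} (hs : IsGenerator M U s)
    {a b : Γ(X, U)} (h : a • s = b • s) : a = b :=
  (hs U le_rfl).1 (by simpa [res_self] using h)

lemma IsGenerator.isUnit {M : X.Modules} {U : X.Opens} {s : Γ(M, U)} (hs : IsGenerator M U s)
    {a : Γ(X, U)} (ha : IsGenerator M U (a • s)) : IsUnit a := by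
  obtain ⟨b, hb⟩ := ha.exists_smul s
  refine IsUnit.of_mul_eq_one_right b (hs.smul_inj ?_)
  rw [mul_smul, hb, one_smul]

/-! ### Tensor products of sheaves and of their sections -/

/-- The presheaf tensor product. -/
abbrev preTensor (M N : X.Modules) : X.PresheafOfModules :=
  PresheafOfModules.Monoidal.tensorObj (R := X.presheaf) M.val N.val

/-- The sheafification map of the presheaf tensor product, on sections over `U`. -/
def tensorToSheaf (M N : X.Modules) (U : X.Opens) :
    Γ(M, U) ⊗[Γ(X, U)] Γ(N, U) →ₗ[Γ(X, U)] Γ(tensor M N, U) :=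
  ((PresheafOfModules.toSheafify (𝟙 X.ringCatSheaf.obj)
    (CategoryTheory.toSheafify (Opens.grothendieckTopology X)
      (preTensor M N).presheaf)).app (.op U)).hom

/-- The tensor product of sections. -/
def tmul (M N : X.Modules) {U : X.Opens} (m : Γ(M, U)) (n : Γ(N, U)) : Γ(tensor M N, U) :=
  tensorToSheaf M N U (m ⊗ₜ n)

/-- Restriction of sections of the presheaf tensor product. -/
def resTensor (M N : X.Modules) {U V : X.Opens} (h : V ≤ U) :
    Γ(M, U) ⊗[Γ(X, U)] Γ(N, U) →+ Γ(M, V) ⊗[Γ(X, V)] Γ(N, V) :=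
  ((preTensor M N).map (homOfLE h).op).hom.toAddMonoidHom

lemma resTensor_tmul (M N : X.Modules) {U V : X.Opens} (h : V ≤ U) (m : Γ(M, U)) (n : Γ(N, U)) :
    resTensor M N h (m ⊗ₜ n) = res M h m ⊗ₜ res N h n := rfl

lemma res_tensorToSheaf (M N : X.Modules) {U V : X.Opens} (h : V ≤ U)
    (t : Γ(M, U) ⊗[Γ(X, U)] Γ(N, U)) :
    res (tensor M N) h (tensorToSheaf M N U t) = tensorToSheaf M N V (resTensor M N h t) :=
  congr($((CategoryTheory.toSheafify (Opens.grothendieckTopology X)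
      (preTensor M N).presheaf).naturality (homOfLE h).op) t).symm

lemma res_tmul (M N : X.Modules) {U V : X.Opens} (h : V ≤ U) (m : Γ(M, U)) (n : Γ(N, U)) :
    res (tensor M N) h (tmul M N m n) = tmul M N (res M h m) (res N h n) :=
  res_tensorToSheaf M N h _

lemma tmul_smul_left (M N : X.Modules) {U : X.Opens} (a : Γ(X, U)) (m : Γ(M, U)) (n : Γ(N, U)) :
    tmul M N (a • m) n = a • tmul M N m n :=
  (tensorToSheaf M N U).map_smul a (m ⊗ₜ n)

lemma tmul_smul_right (M N : X.Modules) {U : X.Opens} (a : Γ(X, U)) (m : Γ(M, U)) (n : Γ(N, U)) :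
    tmul M N m (a • n) = a • tmul M N m n := by
  rw [tmul, TensorProduct.tmul_smul]
  exact (tensorToSheaf M N U).map_smul a (m ⊗ₜ n)

lemma tensorToSheaf_locally_injective (M N : X.Modules) {U : X.Opens}
    {s t : Γ(M, U) ⊗[Γ(X, U)] Γ(N, U)} (h : tensorToSheaf M N U s = tensorToSheaf M N U t) :
    ∀ x ∈ U, ∃ (V : X.Opens) (hV : V ≤ U), x ∈ V ∧ resTensor M N hV s = resTensor M N hV t := by
  intro x hx
  obtain ⟨V, f, hf, hxV⟩ := Presheaf.equalizerSieve_mem (Opens.grothendieckTopology X)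
    (CategoryTheory.toSheafify (Opens.grothendieckTopology X) (preTensor M N).presheaf)
    (X := .op U) s t h x hx
  exact ⟨V, f.le, hxV, hf⟩

lemma tensorToSheaf_locally_surjective (M N : X.Modules) {U : X.Opens} (τ : Γ(tensor M N, U)) :
    ∀ x ∈ U, ∃ (V : X.Opens) (hV : V ≤ U), x ∈ V ∧
      ∃ t, tensorToSheaf M N V t = res (tensor M N) hV τ := by
  intro x hx
  obtain ⟨V, f, hf, hxV⟩ := Presheaf.imageSieve_mem (Opens.grothendieckTopology X)
    (CategoryTheory.toSheafify (Opens.grothendieckTopology X) (preTensor M N).presheaf)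
    (U := .op U) τ x hx
  exact ⟨V, f.le, hxV, hf⟩

/-- Tensors over a ring of two free rank one modules are free of rank one. -/
lemma exists_eq_smul_tmul {M N : X.Modules} {U : X.Opens} {m : Γ(M, U)} {n : Γ(N, U)}
    (hm : IsGenerator M U m) (hn : IsGenerator N U n) (t : Γ(M, U) ⊗[Γ(X, U)] Γ(N, U)) :
    ∃ a : Γ(X, U), t = a • (m ⊗ₜ n) := by
  induction t with
  | zero => exact ⟨0, (zero_smul _ _).symm⟩
  | tmul x y =>
    obtain ⟨a, rfl⟩ := hm.exists_smul x
    obtain ⟨b, rfl⟩ := hn.exists_smul y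
    exact ⟨a * b, by rw [TensorProduct.smul_tmul_smul]⟩
  | add x y hx hy =>
    obtain ⟨a, rfl⟩ := hx
    obtain ⟨b, rfl⟩ := hy
    exact ⟨a + b, (add_smul _ _ _).symm⟩

/-- The coordinate functionals of `m` and `n` multiply to a functional on the tensor product that
sends `m ⊗ n` to `1`. -/
lemma smul_tmul_injective {M N : X.Modules} {U : X.Opens} {m : Γ(M, U)} {n : Γ(N, U)}
    (hm : IsGenerator M U m) (hn : IsGenerator N U n) {a b : Γ(X, U)}
    (h : a • (m ⊗ₜ[Γ(X, U)] n) = b • (m ⊗ₜ n)) : a = b := by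
  have key (P : X.Modules) (p : Γ(P, U)) (hp : IsGenerator P U p) :
      ∃ e : Γ(P, U) →ₗ[Γ(X, U)] Γ(X, U), e p = 1 := by
    have hb : Function.Bijective (LinearMap.toSpanSingleton Γ(X, U) Γ(P, U) p) := by
      convert hp U le_rfl using 2 with c
      simp [res_self]
    refine ⟨(LinearEquiv.ofBijective _ hb).symm, ?_⟩
    apply (LinearEquiv.ofBijective _ hb).injective
    simp
  obtain ⟨e, he⟩ := key M m hm
  obtain ⟨e', he'⟩ := key N n hn
  have := congr(LinearMap.mul' _ _ (TensorProduct.map e e' $h))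
  simpa [he, he'] using this

/-- The tensor product of two generators is a generator. -/
lemma IsGenerator.tmul {M N : X.Modules} {U : X.Opens} {m : Γ(M, U)} {n : Γ(N, U)}
    (hm : IsGenerator M U m) (hn : IsGenerator N U n) :
    IsGenerator (tensor M N) U (tmul M N m n) := by
  -- Injectivity is needed on all smaller open sets first: it makes the local coefficients in the
  -- surjectivity part agree on overlaps.
  have inj : ∀ (V : X.Opens) (h : V ≤ U), Function.Injective fun a : Γ(X, V) ↦
      a • VeryAmpleness.res (tensor M N) h (VeryAmpleness.tmul M N m n) := by
    intro V hV a b hab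
    simp only [res_tmul] at hab
    have hab' : tensorToSheaf M N V (a • (VeryAmpleness.res M hV m ⊗ₜ VeryAmpleness.res N hV n)) =
        tensorToSheaf M N V (b • (VeryAmpleness.res M hV m ⊗ₜ VeryAmpleness.res N hV n)) := by
      rw [map_smul, map_smul]
      exact hab
    refine X.IsSheaf.section_ext fun x hx ↦ ?_
    obtain ⟨W, hW, hxW, h⟩ := tensorToSheaf_locally_injective M N hab' x hx
    refine ⟨W, hW, hxW, smul_tmul_injective (hm.res (hW.trans hV)) (hn.res (hW.trans hV)) ?_⟩
    simp only [TensorProduct.smul_tmul', resTensor_tmul, res_smul, res_res] at h ⊢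
    exact h
  intro V hV
  refine ⟨inj V hV, fun τ ↦ ?_⟩
  have hloc : ∀ x ∈ V, ∃ (W : X.Opens) (hW : W ≤ V), x ∈ W ∧ ∃ a : Γ(X, W),
      a • VeryAmpleness.res (tensor M N) (hW.trans hV) (VeryAmpleness.tmul M N m n) =
        VeryAmpleness.res _ hW τ := by
    intro x hx
    obtain ⟨W, hW, hxW, t, ht⟩ := tensorToSheaf_locally_surjective M N τ x hx
    obtain ⟨a, rfl⟩ := exists_eq_smul_tmul (hm.res (hW.trans hV)) (hn.res (hW.trans hV)) t
    exact ⟨W, hW, hxW, a, by rw [← ht, map_smul, res_tmul]; rfl⟩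
  choose W hW hx a ha using hloc
  obtain ⟨b, hb⟩ : ∃ b : Γ(X, V), ∀ x : V, X.presheaf.map (homOfLE (hW x x.2)).op b = a x x.2 := by
    obtain ⟨b, hb, -⟩ := TopCat.Sheaf.existsUnique_gluing' X.sheaf (fun x : V ↦ W x x.2) V
      (fun x ↦ homOfLE (hW x x.2)) (fun x hx' ↦ Opens.mem_iSup.mpr ⟨⟨x, hx'⟩, hx x hx'⟩)
      (fun x ↦ a x x.2) (by
        intro x y
        apply inj _ (inf_le_left.trans ((hW x x.2).trans hV))
        have h1 := congr(VeryAmpleness.res _ (inf_le_left : W x x.2 ⊓ W y y.2 ≤ W x x.2) $(ha x x.2))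
        have h2 := congr(VeryAmpleness.res _ (inf_le_right : W x x.2 ⊓ W y y.2 ≤ W y y.2) $(ha y y.2))
        simp only [res_smul, res_res] at h1 h2 ⊢
        exact h1.trans h2.symm)
    exact ⟨b, hb⟩
  refine ⟨b, eq_of_locally_eq _ fun x hxV ↦ ⟨W x hxV, hW x hxV, hx x hxV, ?_⟩⟩
  simp only [res_smul, res_res]
  rw [← ha x hxV, ← hb ⟨x, hxV⟩]

/-! ### Isomorphisms detected on generators, and transport of restriction maps -/

lemma HasLocalGenerators.exists_le {M : X.Modules} (hM : HasLocalGenerators M) {U : X.Opens} {x : X}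
    (hx : x ∈ U) : ∃ V : X.Opens, V ≤ U ∧ x ∈ V ∧ ∃ s : Γ(M, V), IsGenerator M V s := by
  obtain ⟨V, hxV, s, hs⟩ := hM x
  exact ⟨V ⊓ U, inf_le_right, ⟨hxV, hx⟩, _, hs.res inf_le_left⟩

lemma HasLocalGenerators.exists_le₂ {M N : X.Modules} (hM : HasLocalGenerators M)
    (hN : HasLocalGenerators N) {U : X.Opens} {x : X} (hx : x ∈ U) :
    ∃ V : X.Opens, V ≤ U ∧ x ∈ V ∧ (∃ s : Γ(M, V), IsGenerator M V s) ∧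
      ∃ t : Γ(N, V), IsGenerator N V t := by
  obtain ⟨V, hVU, hxV, s, hs⟩ := hM.exists_le hx
  obtain ⟨W, hWV, hxW, t, ht⟩ := hN.exists_le hxV
  exact ⟨W, hWV.trans hVU, hxW, ⟨_, hs.res hWV⟩, t, ht⟩

/-- A morphism sending local generators to local generators is an isomorphism. -/
lemma isIso_of_isGenerator {M N : X.Modules} (φ : M ⟶ N)
    (h : ∀ x, ∃ U : X.Opens, x ∈ U ∧ ∃ s : Γ(M, U), IsGenerator M U s ∧
      IsGenerator N U (φ.app U s)) : IsIso φ := by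
  have hloc (W : X.Opens) (x : X) (hx : x ∈ W) : ∃ V : X.Opens, V ≤ W ∧ x ∈ V ∧
      ∀ V' ≤ V, Function.Bijective (φ.app V') := by
    obtain ⟨U, hxU, s, hs, hs'⟩ := h x
    refine ⟨U ⊓ W, inf_le_right, ⟨hxU, hx⟩, fun V hV ↦ ?_⟩
    have hVU : V ≤ U := hV.trans inf_le_left
    refine (Function.Bijective.of_comp_iff _ (hs V hVU)).mp ?_
    convert hs' V hVU using 2 with a
    simp [app_res]
  have inj (W : X.Opens) : Function.Injective (φ.app W) := fun a b hab ↦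
    eq_of_locally_eq M fun x hx ↦ by
      obtain ⟨V, hVW, hxV, hV⟩ := hloc W x hx
      refine ⟨V, hVW, hxV, (hV V le_rfl).1 ?_⟩
      rw [app_res, app_res, hab]
  refine Scheme.Modules.Hom.isIso_iff_isIso_app.mpr fun W ↦ ?_
  rw [ConcreteCategory.isIso_iff_bijective]
  refine ⟨inj W, fun b ↦ ?_⟩
  choose V hVW hxV hV using hloc W
  choose a ha using fun x : W ↦ (hV x x.2 _ le_rfl).2 (res N (hVW x x.2) b)
  obtain ⟨t, ht⟩ := exists_glue M (fun x : W ↦ V x x.2) W (fun x ↦ hVW x x.2)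
    (fun x hx ↦ Opens.mem_iSup.mpr ⟨⟨x, hx⟩, hxV x hx⟩) a fun x y ↦ inj _ (by
      rw [app_res, app_res, ha, ha, res_res, res_res])
  refine ⟨t, eq_of_locally_eq N fun x hx ↦ ⟨V x hx, hVW x hx, hxV x hx, ?_⟩⟩
  rw [← app_res, ht ⟨x, hx⟩]
  exact ha ⟨x, hx⟩

/-- A family of linear maps on sections over open subsets of `W` that preserves generators
identifies the restrictions to `W`. -/
lemma nonempty_restrict_iso {A T : X.Modules} (hA : HasLocalGenerators A) (W : X.Opens)
    (β : ∀ U ≤ W, Γ(A, U) →+ Γ(T, U))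
    (hsmul : ∀ U hU (a : Γ(X, U)) s, β U hU (a • s) = a • β U hU s)
    (hres : ∀ U hU V (h : V ≤ U) s, β V (h.trans hU) (res A h s) = res T h (β U hU s))
    (hgen : ∀ U hU s, IsGenerator A U s → IsGenerator T U (β U hU s)) :
    Nonempty (A.restrict W.ι ≅ T.restrict W.ι) := by
  have hle (V : (W : Scheme).Opens) : W.ι ''ᵁ V ≤ W := by
    simpa using W.ι.image_le_opensRange V
  let ψ : (A.restrict W.ι).val.presheaf ⟶ (T.restrict W.ι).val.presheaf :=
    { app := fun V ↦ AddCommGrpCat.ofHom (β (W.ι ''ᵁ V.unop) (hle _))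
      naturality := fun U V f ↦ by
        ext s
        exact hres _ (hle _) _ (W.ι.image_mono f.unop.le) s }
  let φ : A.restrict W.ι ⟶ T.restrict W.ι :=
    ⟨PresheafOfModules.homMk ψ fun V r m ↦ hsmul _ (hle _) _ m⟩
  have : IsIso φ := isIso_of_isGenerator φ fun x ↦ by
    obtain ⟨U, hxU, s, hs⟩ := hA (W.ι x)
    refine ⟨W.ι ⁻¹ᵁ U, hxU, (res A (W.ι.image_preimage_le U) s : Γ(A, W.ι ''ᵁ W.ι ⁻¹ᵁ U)),
      hs.restrict W.ι, (isGenerator_restrict_iff W.ι _ _).mpr (hgen _ (hle _) _ (hs.res _))⟩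
  exact ⟨asIso φ⟩

/-- Modules that agree on an open subset containing the image of `σ` have the same pullback. -/
lemma nonempty_pull_iso {A T : Y.Modules} (W : Y.Opens) (e : A.restrict W.ι ≅ T.restrict W.ι)
    (σ : X ⟶ Y) (hσ : σ ⁻¹ᵁ W = ⊤) : Nonempty (pull σ A ≅ pull σ T) := by
  let σ' : X ⟶ W := IsOpenImmersion.lift W.ι σ (by
    rintro _ ⟨x, rfl⟩
    have : x ∈ σ ⁻¹ᵁ W := hσ ▸ trivial
    simpa using this)
  have h : σ' ≫ W.ι = σ := IsOpenImmersion.lift_fac _ _ _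
  let E (B : Y.Modules) : pull σ B ≅ pull σ' (B.restrict W.ι) :=
    (Scheme.Modules.pullbackCongr h.symm).app B ≪≫
      ((Scheme.Modules.pullbackComp σ' W.ι).app B).symm ≪≫
      (Scheme.Modules.pullback σ').mapIso
        ((Scheme.Modules.restrictFunctorIsoPullback W.ι).app B).symm
  exact ⟨E A ≪≫ (Scheme.Modules.pullback σ').mapIso e ≪≫ (E T).symm⟩

lemma restrictionMap_surjective_of_iso (i : Z ⟶ X) {A B : X.Modules} (e : A ≅ B)
    (h : Function.Surjective (restrictionMap i A)) : Function.Surjective (restrictionMap i B) := by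
  intro b
  obtain ⟨c, rfl⟩ := (app_bijective ((Scheme.Modules.pullback i).map e.hom) ⊤).2 b
  obtain ⟨a, rfl⟩ := h c
  exact ⟨e.hom.app ⊤ a, (sec_map i e.hom ⊤ a).symm⟩

lemma restrictionMap_surjective_of_comp (i : Z ⟶ X) (σ : X ⟶ Y) (T : Y.Modules)
    (h : Function.Surjective (restrictionMap (i ≫ σ) T)) :
    Function.Surjective (restrictionMap i (pull σ T)) := by
  intro b
  obtain ⟨a, ha⟩ := h (((Scheme.Modules.pullbackComp i σ).hom.app T).app ⊤ b)
  refine ⟨sec σ T ⊤ a, (app_bijective ((Scheme.Modules.pullbackComp i σ).hom.app T) ⊤).1 ?_⟩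
  exact (sec_comp i σ T ⊤ a).trans ha

/-- Since `σ` lands in `W`, `σ^* T ≅ σ^* A = σ^* p^* L ≅ L`. It will be applied with `T` the
external tensor product and `σ` a section of a projection. -/
lemma restrictionMap_surjective_of_section {A T : Y.Modules} {L : X.Modules} (W : Y.Opens)
    (e : A.restrict W.ι ≅ T.restrict W.ι) (σ : X ⟶ Y) (hσ : σ ⁻¹ᵁ W = ⊤) (p : Y ⟶ X)
    (hp : σ ≫ p = 𝟙 X) (hA : A = pull p L) (i : Z ⟶ X) 
    (h : Function.Surjective (restrictionMap (i ≫ σ) T)) :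
    Function.Surjective (restrictionMap i L) := by
  subst hA
  obtain ⟨e'⟩ := nonempty_pull_iso W e σ hσ
  refine restrictionMap_surjective_of_iso i (e'.symm ≪≫ (Scheme.Modules.pullbackComp σ p).app L ≪≫
    (Scheme.Modules.pullbackCongr hp).app L ≪≫ (Scheme.Modules.pullbackId X).app L) 
    (restrictionMap_surjective_of_comp i σ T h)

lemma tmul_add (M N : X.Modules) {U : X.Opens} (m : Γ(M, U)) (n n' : Γ(N, U)) :
    tmul M N m (n + n') = tmul M N m n + tmul M N m n' := by
  simp [tmul, TensorProduct.tmul_add]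

lemma add_tmul (M N : X.Modules) {U : X.Opens} (m m' : Γ(M, U)) (n : Γ(N, U)) :
    tmul M N (m + m') n = tmul M N m n + tmul M N m' n := by
  simp [tmul, TensorProduct.add_tmul]

/-- Tensoring with the generator `n` sends generators to generators. -/
lemma nonempty_restrict_iso_tensor_left {M N : X.Modules} (hM : HasLocalGenerators M)
    {W : X.Opens} {n : Γ(N, W)} (hn : IsGenerator N W n) :
    Nonempty (M.restrict W.ι ≅ (tensor M N).restrict W.ι) :=
  nonempty_restrict_iso hM W
    (fun U hU ↦ AddMonoidHom.mk' (fun m ↦ tmul M N m (res N hU n)) fun a b ↦ add_tmul ..)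
    (fun U hU a s ↦ tmul_smul_left ..)
    (fun U hU V h s ↦ by simp [res_tmul, res_res])
    (fun U hU s hs ↦ hs.tmul (hn.res hU))

lemma nonempty_restrict_iso_tensor_right {M N : X.Modules} (hN : HasLocalGenerators N)
    {W : X.Opens} {m : Γ(M, W)} (hm : IsGenerator M W m) :
    Nonempty (N.restrict W.ι ≅ (tensor M N).restrict W.ι) :=
  nonempty_restrict_iso hN W
    (fun U hU ↦ AddMonoidHom.mk' (fun n ↦ tmul M N (res M hU m) n) fun a b ↦ tmul_add ..)
    (fun U hU a s ↦ tmul_smul_right ..)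
    (fun U hU V h s ↦ by simp [res_tmul, res_res])
    (fun U hU s hs ↦ (hm.res hU).tmul hs)

/-! ### Restricting tensors of global sections -/

/-- The pullback of global sections along `f`. -/
def gsec (f : Z ⟶ X) (L : X.Modules) : Γ(L, ⊤) →+ Γ(pull f L, ⊤) := sec f L ⊤

lemma sec_top_res (f : Z ⟶ X) (L : X.Modules) (V : X.Opens) (s : Γ(L, ⊤)) :
    sec f L V (res L le_top s) = res (pull f L) le_top (gsec f L s) :=
  sec_res f L le_top s

lemma gsec_smul (f : Z ⟶ X) (L : X.Modules) (a : Γ(X, ⊤)) (s : Γ(L, ⊤)) :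
    gsec f L (a • s) = f.appTop a • gsec f L s :=
  sec_smul f L ⊤ a s

/-- Pulling back a tensor product of sections only depends on the pullbacks of the factors. -/
lemma sec_tmul_of_smul {M N : Y.Modules} (hM : HasLocalGenerators M) (hN : HasLocalGenerators N)
    (f : Z ⟶ Y) {m m' : Γ(M, ⊤)} {n n' : Γ(N, ⊤)} {a b : Γ(Z, ⊤)}
    (hm : gsec f M m = a • gsec f M m') (hn : gsec f N n = b • gsec f N n') :
    gsec f (tensor M N) (tmul M N m n) = (a * b) • gsec f (tensor M N) (tmul M N m' n') := by
  refine eq_of_locally_eq _ fun z _ ↦ ?_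
  obtain ⟨V, -, hzV, ⟨μ, hμ⟩, ν, hν⟩ := hM.exists_le₂ hN (U := ⊤) (x := f z) trivial
  refine ⟨f ⁻¹ᵁ V, le_top, hzV, ?_⟩
  obtain ⟨c, hc⟩ := hμ.exists_smul (res M le_top m)
  obtain ⟨c', hc'⟩ := hμ.exists_smul (res M le_top m')
  obtain ⟨d, hd⟩ := hν.exists_smul (res N le_top n)
  obtain ⟨d', hd'⟩ := hν.exists_smul (res N le_top n')
  -- The relation `hm` holds only after pullback, so it is read off as a relation of coefficients
  -- against the pulled-back generator `μ`.
  have h1 : f.app V c = Z.presheaf.map (homOfLE le_top).op a * f.app V c' := by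
    apply (hμ.sec f).smul_inj
    have := congr(res _ (le_top : f ⁻¹ᵁ V ≤ ⊤) $hm)
    rw [mul_smul, ← sec_smul, ← sec_smul, hc, hc', sec_top_res, sec_top_res, ← res_smul]
    exact this
  have h2 : f.app V d = Z.presheaf.map (homOfLE le_top).op b * f.app V d' := by
    apply (hν.sec f).smul_inj
    have := congr(res _ (le_top : f ⁻¹ᵁ V ≤ ⊤) $hn)
    rw [mul_smul, ← sec_smul, ← sec_smul, hd, hd', sec_top_res, sec_top_res, ← res_smul]
    exact this
  have key (x : Γ(M, ⊤)) (y : Γ(N, ⊤)) (p q : Γ(Y, V)) (hp : p • μ = res M le_top x)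
      (hq : q • ν = res N le_top y) : res _ (le_top : f ⁻¹ᵁ V ≤ ⊤) 
        (gsec f (tensor M N) (tmul M N x y)) =
      (f.app V p * f.app V q) • sec f (tensor M N) V (tmul M N μ ν) := by
    rw [← map_mul, ← sec_smul, mul_smul, ← tmul_smul_right, ← tmul_smul_left, hp, hq, ← res_tmul]
    exact (sec_top_res f (tensor M N) _ _).symm
  rw [res_smul]
  rw [key _ _ _ _ hc hd, key _ _ _ _ hc' hd', smul_smul, h1, h2, map_mul]
  congr 1
  ring

/-- `m` and `n` need not generate on `Y`. Their coefficients against local generators `μ`, `ν`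
become units on `Z`, so `m ⊗ n` pulls back to a unit times the pullback of `μ ⊗ ν`. -/
lemma isGenerator_sec_tmul {M N : Y.Modules} (hM : HasLocalGenerators M)
    (hN : HasLocalGenerators N) (f : Z ⟶ Y) {m : Γ(M, ⊤)} {n : Γ(N, ⊤)}
    (hm : IsGenerator (pull f M) ⊤ (gsec f M m)) (hn : IsGenerator (pull f N) ⊤ (gsec f N n)) :
    IsGenerator (pull f (tensor M N)) ⊤ (gsec f (tensor M N) (tmul M N m n)) := by
  refine IsGenerator.of_locally fun z _ ↦ ?_
  obtain ⟨V, -, hzV, ⟨μ, hμ⟩, ν, hν⟩ := hM.exists_le₂ hN (U := ⊤) (x := f z) trivial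
  refine ⟨f ⁻¹ᵁ V, le_top, hzV, ?_⟩
  obtain ⟨c, hc⟩ := hμ.exists_smul (res M le_top m)
  obtain ⟨d, hd⟩ := hν.exists_smul (res N le_top n)
  have h1 : IsUnit (f.app V c) := by
    apply (hμ.sec f).isUnit
    rw [← sec_smul, hc, sec_top_res]
    exact hm.res le_top
  have h2 : IsUnit (f.app V d) := by
    apply (hν.sec f).isUnit
    rw [← sec_smul, hd, sec_top_res]
    exact hn.res le_top
  have := ((hμ.tmul hν).sec f).unit_smul (h1.mul h2)
  rw [← map_mul, ← sec_smul, mul_smul, ← tmul_smul_right, ← tmul_smul_left, hc, hd, ← res_tmul,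
    sec_top_res] at this
  exact this

/-- The two ways of pulling back along a commutative square agree. -/
lemma exists_iso_of_comm {W : Scheme.{0}} {f : Z ⟶ Y} {p : Y ⟶ X} {g : Z ⟶ W} {j : W ⟶ X}
    (h : f ≫ p = g ≫ j) (L : X.Modules) :
    ∃ φ : pull f (pull p L) ⟶ pull g (pull j L), IsIso φ ∧ ∀ s : Γ(L, ⊤),
      φ.app ⊤ (gsec f _ (gsec p L s)) = gsec g _ (gsec j L s) := by
  obtain ⟨φ, hφ, H⟩ := sec_congr h L
  refine ⟨(Scheme.Modules.pullbackComp f p).hom.app L ≫ φ ≫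
    (Scheme.Modules.pullbackComp g j).inv.app L, inferInstance, fun s ↦ ?_⟩
  apply (app_bijective ((Scheme.Modules.pullbackComp g j).hom.app L) ⊤).1
  refine Eq.trans ?_ (sec_comp g j L ⊤ s).symm
  have h2 := congr(($((Scheme.Modules.pullbackComp g j).inv_hom_id_app L)).app ⊤
    (φ.app ⊤ (sec (f ≫ p) L ⊤ s)))
  have h3 := congr(φ.app ⊤ $(sec_comp f p L ⊤ s))
  have h4 := (H ⊤ s).trans (res_self _ _ _)
  refine Eq.trans ?_ (h2.trans h4)
  exact congr(((Scheme.Modules.pullbackComp g j).hom.app L).app ⊤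
    (((Scheme.Modules.pullbackComp g j).inv.app L).app ⊤ $h3))

/-! ### Lengths of complex schemes -/

/-- The complex scalars inside the global functions of a complex scheme. -/
def scalars (s : Z ⟶ SpecC) : ℂ →+* Γ(Z, ⊤) :=
  ((Scheme.ΓSpecIso (CommRingCat.of ℂ)).inv ≫ s.appTop).hom

/-- The complex dimension of a ring containing the complex numbers. -/
def complexDim {A : Type*} [CommRing A] (φ : ℂ →+* A) : ℕ :=
  letI := φ.toAlgebra
  Module.finrank ℂ A

lemma hZero_eq (s : Z ⟶ SpecC) : hZero s = complexDim (scalars s) := rfl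

lemma scalars_comp (g : Z ⟶ W) (s : W ⟶ SpecC) :
    scalars (g ≫ s) = g.appTop.hom.comp (scalars s) := by
  simp only [scalars, Scheme.Hom.comp_appTop, CommRingCat.hom_comp, RingHom.comp_assoc]

lemma finite_of_complexDim_pos {A : Type*} [CommRing A] {φ : ℂ →+* A} (h : 0 < complexDim φ) :
    φ.Finite := by
  let := φ.toAlgebra
  exact Module.finite_of_finrank_pos h

/-- Used to bound the length of a scheme-theoretic image by the length of the source. Finiteness is
carried along because `finrank` is `0` in infinite dimension. -/
lemma finite_and_complexDim_le {A B : Type*} [CommRing A] [CommRing B] {φ : ℂ →+* A} {ψ : ℂ →+* B}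
    (f : A →+* B) (hf : Function.Injective f) (h : ψ = f.comp φ) (hψ : ψ.Finite) :
    φ.Finite ∧ complexDim φ ≤ complexDim ψ := by
  let := φ.toAlgebra
  let := ψ.toAlgebra
  have : Module.Finite ℂ B := hψ
  let F : A →ₐ[ℂ] B := { f with commutes' := fun c ↦ congr($h c).symm }
  exact ⟨Module.Finite.of_injective F.toLinearMap hf,
    LinearMap.finrank_le_finrank_of_injective (f := F.toLinearMap) hf⟩

lemma finite_and_complexDim_prod {A B P : Type*} [CommRing A] [CommRing B] [CommRing P]
    {φ : ℂ →+* A} {ψ : ℂ →+* B} {χ : ℂ →+* P} (p : P →+* A) (q : P →+* B)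
    (hpq : Function.Bijective (p.prod q)) (hp : φ = p.comp χ) (hq : ψ = q.comp χ) (hφ : φ.Finite) (hψ : ψ.Finite) :
    χ.Finite ∧ complexDim χ = complexDim φ + complexDim ψ := by
  let := φ.toAlgebra
  let := ψ.toAlgebra
  let := χ.toAlgebra
  have : Module.Finite ℂ A := hφ
  have : Module.Finite ℂ B := hψ
  let E : P ≃ₐ[ℂ] A × B := 
    { RingEquiv.ofBijective (p.prod q) hpq with
      commutes' := fun c ↦ Prod.ext congr($hp c).symm congr($hq c).symm }
  exact ⟨Module.Finite.equiv E.symm.toLinearEquiv,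
    E.toLinearEquiv.finrank_eq.trans (Module.finrank_prod ..)⟩

lemma bijective_scalars_id : Function.Bijective (scalars (𝟙 SpecC)) := by
  have : scalars (𝟙 SpecC) = (Scheme.ΓSpecIso (CommRingCat.of ℂ)).inv.hom := by
    simp [scalars]
  rw [this]
  exact ConcreteCategory.bijective_of_isIso (Scheme.ΓSpecIso (CommRingCat.of ℂ)).inv

lemma finite_and_complexDim_of_bijective {A : Type*} [CommRing A] {φ : ℂ →+* A}
    (h : Function.Bijective φ) : φ.Finite ∧ complexDim φ = 1 := by
  let := φ.toAlgebra
  let e : ℂ ≃ₗ[ℂ] A := LinearEquiv.ofBijective (Algebra.linearMap ℂ A) h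
  exact ⟨Module.Finite.equiv e, e.finrank_eq.symm.trans (Module.finrank_self ℂ)⟩

lemma bijective_coprod_sections (X Y : Scheme.{0}) : Function.Bijective
    ((Limits.coprod.inl : X ⟶ X ⨿ Y).appTop.hom.prod (Limits.coprod.inr : Y ⟶ X ⨿ Y).appTop.hom) := by
  let A := Γ(X, (Limits.coprod.inl : X ⟶ X ⨿ Y) ⁻¹ᵁ ⊤)
  let B := Γ(Y, (Limits.coprod.inr : Y ⟶ X ⨿ Y) ⁻¹ᵁ ⊤)
  let e := (Limits.limit.isLimit _).conePointUniqueUpToIso (CommRingCat.prodFanIsLimit A B)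
  let E := Scheme.coprodPresheafObjIso (X := X) (Y := Y) ⊤ ≪≫ e
  have hfst : E.hom ≫ CommRingCat.ofHom (RingHom.fst A B) =
      (Limits.coprod.inl : X ⟶ X ⨿ Y).appTop := by
    have : e.hom ≫ CommRingCat.ofHom (RingHom.fst A B) = Limits.prod.fst :=
      Limits.IsLimit.conePointUniqueUpToIso_hom_comp _ (CommRingCat.prodFanIsLimit A B) (.mk .left)
    refine Eq.trans ?_ (Scheme.coprodPresheafObjIso_hom_fst ⊤)
    rw [← this]
    rfl
  have hsnd : E.hom ≫ CommRingCat.ofHom (RingHom.snd A B) =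
      (Limits.coprod.inr : Y ⟶ X ⨿ Y).appTop := by
    have : e.hom ≫ CommRingCat.ofHom (RingHom.snd A B) = Limits.prod.snd :=
      Limits.IsLimit.conePointUniqueUpToIso_hom_comp _ (CommRingCat.prodFanIsLimit A B) (.mk .right)
    refine Eq.trans ?_ (Scheme.coprodPresheafObjIso_hom_snd ⊤)
    rw [← this]
    rfl
  have := ConcreteCategory.bijective_of_isIso E.hom
  rw [← hfst, ← hsnd]
  exact this

lemma finite_and_hZero_coprod (s : Z ⟶ SpecC) (hs : (scalars s).Finite) :
    (scalars (Limits.coprod.desc s (𝟙 SpecC))).Finite ∧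
      hZero (Limits.coprod.desc s (𝟙 SpecC)) = hZero s + 1 := by
  obtain ⟨h1, h2⟩ := finite_and_complexDim_of_bijective bijective_scalars_id
  rw [hZero_eq, hZero_eq, ← h2]
  have hl := scalars_comp (Limits.coprod.inl : Z ⟶ Z ⨿ SpecC) (Limits.coprod.desc s (𝟙 SpecC))
  have hr := scalars_comp (Limits.coprod.inr : _ ⟶ Z ⨿ SpecC) (Limits.coprod.desc s (𝟙 SpecC))
  rw [Limits.coprod.inl_desc] at hl
  rw [Limits.coprod.inr_desc] at hr
  exact finite_and_complexDim_prod _ _ (bijective_coprod_sections Z SpecC) hl hr hs h1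

/-! ### Finite discrete schemes, and enlarging a subscheme by points -/

/-- A sheaf of modules on a discrete scheme that is locally generated by one section is so
globally. -/
lemma HasLocalGenerators.exists_global [DiscreteTopology W] {F : W.Modules}
    (hF : HasLocalGenerators F) : ∃ e : Γ(F, ⊤), IsGenerator F ⊤ e := by
  have h (x : W) : ∃ s : Γ(F, (⟨{x}, isOpen_discrete _⟩ : W.Opens)), IsGenerator F _ s := by
    obtain ⟨U, hU, s, hs⟩ := hF x
    exact ⟨_, hs.res (by rintro _ rfl; exact hU)⟩
  choose s hs using h
  obtain ⟨t, ht⟩ := exists_glue F (fun x : W ↦ ⟨{x}, isOpen_discrete _⟩) ⊤ (fun _ ↦ le_top)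
    (fun x _ ↦ Opens.mem_iSup.mpr ⟨x, rfl⟩) s fun x y ↦ by
      rcases eq_or_ne x y with rfl | hxy
      · rfl
      · exact eq_of_locally_eq F fun z hz ↦ (hxy (hz.1.symm.trans hz.2)).elim
  refine ⟨t, IsGenerator.of_locally fun x _ ↦ ⟨⟨{x}, isOpen_discrete _⟩, le_top, rfl, ?_⟩⟩
  rw [ht x]
  exact hs x

/-- A global generator of `F` turns the question into surjectivity on functions. -/
lemma restrictionMap_surjective_of_discrete [DiscreteTopology W] {F : W.Modules}
    (hF : HasLocalGenerators F) (j : Z ⟶ W) (hj : Function.Surjective j.appTop) :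
    Function.Surjective (restrictionMap j F) := by
  obtain ⟨e, he⟩ := hF.exists_global
  intro t
  obtain ⟨a, rfl⟩ := (he.sec j).exists_smul t
  obtain ⟨b, rfl⟩ := hj a
  exact ⟨b • e, gsec_smul j F b e⟩

lemma restrictionMap_surjective_comp (i : Z ⟶ X) (σ : X ⟶ Y) (T : Y.Modules)
    (hi : Function.Surjective (restrictionMap i (pull σ T)))
    (hσ : Function.Surjective (restrictionMap σ T)) :
    Function.Surjective (restrictionMap (i ≫ σ) T) := by
  intro b
  obtain ⟨c, rfl⟩ := (app_bijective ((Scheme.Modules.pullbackComp i σ).hom.app T) ⊤).2 b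
  obtain ⟨d, rfl⟩ := hi c
  obtain ⟨a, rfl⟩ := hσ d
  exact ⟨a, (sec_comp i σ T ⊤ a).symm⟩

lemma topologicalKrullDim_eq_zero [DiscreteTopology Z] [Nonempty Z] : topologicalKrullDim Z = 0 :=
  (topologicalKrullDim_zero_of_discreteTopology Z).antisymm <|
    have : Nonempty (IrreducibleCloseds Z) :=
      ⟨⟨{Classical.arbitrary Z}, isIrreducible_singleton, isClosed_discrete _⟩⟩
    Order.krullDim_nonneg

lemma nonempty_of_hZero_pos {s : Z ⟶ SpecC} (h : 0 < hZero s) : Nonempty Z := by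
  by_contra hZ
  rw [not_nonempty_iff] at hZ
  let := (scalars s).toAlgebra
  have : Subsingleton Γ(Z, ⊤) := inferInstance
  have h0 : Module.finrank ℂ Γ(Z, ⊤) = 0 := Module.finrank_zero_of_subsingleton
  exact h.ne' h0

/-- Adding a closed rational point outside of a finite closed subscheme. -/
lemma isClosedImmersion_coprodDesc [Finite Z] [DiscreteTopology Z] (s : X ⟶ SpecC)
    [LocallyOfFiniteType s] (i : Z ⟶ X) [IsClosedImmersion i] (x : X) (hx : IsClosed {x})
    (hxi : x ∉ Set.range i) :
    IsClosedImmersion (Limits.coprod.desc i (pointOfClosedPoint s x hx)) := by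
  let d := Limits.coprod.desc i (pointOfClosedPoint s x hx)
  have hl (z : Z) : d (coprodMk _ _ (.inl z)) = i z := by
    rw [coprodMk_inl, ← Scheme.Hom.comp_apply, Limits.coprod.inl_desc]
  have hr (z : SpecC) : d (coprodMk _ _ (.inr z)) = x := by
    rw [coprodMk_inr, ← Scheme.Hom.comp_apply, Limits.coprod.inr_desc]
    simp
  have hsub : Subsingleton SpecC := inferInstanceAs (Subsingleton (PrimeSpectrum ℂ))
  have hfin : Finite (Z ⊕ SpecC) := inferInstance
  have : Finite (Z ⨿ SpecC : Scheme) := Finite.of_equiv _ (coprodMk Z SpecC).toEquiv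
  have hinj : Function.Injective d := by
    intro a b hab
    obtain ⟨a, rfl⟩ := (coprodMk _ _).surjective a
    obtain ⟨b, rfl⟩ := (coprodMk _ _).surjective b
    congr 1
    rcases a with a | a <;> rcases b with b | b
    · rw [hl, hl] at hab
      rw [i.isEmbedding.injective hab]
    · rw [hl, hr] at hab
      exact (hxi ⟨a, hab⟩).elim
    · rw [hl, hr] at hab
      exact (hxi ⟨b, hab.symm⟩).elim
    · rw [Subsingleton.elim a b]
  have hclosed (z) : IsClosed {d z} := by
    obtain ⟨z, rfl⟩ := (coprodMk _ _).surjective z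
    rcases z with z | z
    · rw [hl]
      simpa using i.isClosedEmbedding.isClosedMap {z} (isClosed_discrete _)
    · rwa [hr]
  have : Topology.IsClosedEmbedding d := .of_continuous_injective_isClosedMap d.continuous hinj fun S _ ↦ by
    rw [← Set.biUnion_of_singleton S, Set.image_iUnion₂]
    refine Set.Finite.isClosed_biUnion S.toFinite fun z _ ↦ ?_
    simpa using hclosed z
  -- Surjectivity on stalks is local on the source, so it is checked on the two summands.
  have hs : SurjectiveOnStalks d := by
    rw [IsZariskiLocalAtSource.iff_of_openCover (P := @SurjectiveOnStalks) (coprodOpenCover.{0, 0} Z SpecC)]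
    have := isClosedImmersion_of_comp_eq_id _ _ (pointOfClosedPoint_comp s x hx)
    rintro (_ | _)
    · change SurjectiveOnStalks (Limits.coprod.inl ≫ d)
      rw [Limits.coprod.inl_desc]
      infer_instance
    · change SurjectiveOnStalks (Limits.coprod.inr ≫ d)
      rw [Limits.coprod.inr_desc]
      infer_instance
  exact { isClosedEmbedding := this, toSurjectiveOnStalks := hs }

lemma appTop_surjective [Finite W] [DiscreteTopology W] (j : Z ⟶ W) [IsClosedImmersion j] :
    Function.Surjective j.appTop :=
  (IsClosedImmersion.isAffine_surjective_of_isAffine j).2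

/-- For a finite closed subscheme of length at most `k + 1`, sections of a `k`-very ample sheaf
can be lifted. -/
lemma IsVeryAmpleOfOrder.restrictionMap_surjective {s : X ⟶ SpecC} [LocallyOfFiniteType s]
    {L : X.Modules} (hL : HasLocalGenerators L) {k : ℕ} (hk : IsVeryAmpleOfOrder s k L) (d : ℕ) :
    ∀ (Z : Scheme.{0}) (i : Z ⟶ X) [IsClosedImmersion i] [Finite Z] [DiscreteTopology Z],
      (scalars (i ≫ s)).Finite → hZero (i ≫ s) + d = k + 1 →
      Function.Surjective (restrictionMap i L) := by
  induction d with
  | zero =>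
    intro Z i _ _ _ hfin hd
    -- The Krull dimension of the empty space is not `0`, so nonemptiness has to come from the
    -- positive length `k + 1`.
    have : Nonempty Z := nonempty_of_hZero_pos (s := i ≫ s) (by omega)
    exact hk Z i inferInstance topologicalKrullDim_eq_zero (by omega)
  | succ d ih =>
    intro Z i _ _ _ hfin hd
    -- If no closed point is left to add, closed points being dense, `X` is itself finite and
    -- discrete, and lifting needs no very ampleness. Otherwise a new point raises the length by
    -- one, and induction applies to the larger subscheme.
    by_cases hX : closedPoints X ⊆ Set.range i
    · have := LocallyOfFiniteType.jacobsonSpace s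
      have hsurj : Function.Surjective i := by
        rw [← Set.range_eq_univ, ← Set.univ_subset_iff, ← closure_closedPoints (X := X)]
        exact closure_minimal hX i.isClosedEmbedding.isClosed_range
      have : Finite X := Finite.of_surjective _ hsurj
      have : DiscreteTopology X :=
        (i.isClosedEmbedding.isEmbedding.toHomeomorphOfSurjective hsurj).discreteTopology
      exact restrictionMap_surjective_of_discrete hL i (appTop_surjective i)
    · obtain ⟨x, hx, hxi⟩ := Set.not_subset.mp hX
      have hp := pointOfClosedPoint_comp s x hx
      set p := pointOfClosedPoint s x hx with hpdef
      have := isClosedImmersion_coprodDesc s i x hx hxi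
      rw [← hpdef] at this
      have hdesc : Limits.coprod.desc i p ≫ s = Limits.coprod.desc (i ≫ s) (𝟙 SpecC) := by
        apply Limits.coprod.hom_ext <;> simp [hp]
      obtain ⟨h1, h2⟩ := finite_and_hZero_coprod (i ≫ s) hfin
      rw [← hdesc] at h1 h2
      have hsub : Subsingleton SpecC := inferInstanceAs (Subsingleton (PrimeSpectrum ℂ))
      have : Finite (Z ⨿ SpecC : Scheme) := Finite.of_equiv _ (coprodMk Z SpecC).toEquiv
      have : DiscreteTopology (Z ⨿ SpecC : Scheme) := (coprodMk Z SpecC).discreteTopology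
      have h3 := ih (Z ⨿ SpecC) (Limits.coprod.desc i p) h1 (by omega)
      have h4 : (Limits.coprod.inl : Z ⟶ Z ⨿ SpecC) ≫ Limits.coprod.desc i p = i :=
        Limits.coprod.inl_desc _ _
      have h5 : IsClosedImmersion (Limits.coprod.inl : Z ⟶ Z ⨿ SpecC) := by
        have : IsClosedImmersion ((Limits.coprod.inl : Z ⟶ Z ⨿ SpecC) ≫ Limits.coprod.desc i p) := by
          rw [h4]; infer_instance
        exact .of_comp _ (Limits.coprod.desc i p)
      have h6 := restrictionMap_surjective_comp _ _ L
        (restrictionMap_surjective_of_discrete (hL.pull (Limits.coprod.desc i p))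
          (Limits.coprod.inl : Z ⟶ Z ⨿ SpecC) (appTop_surjective _)) h3
      rwa [h4] at h6

/-! ### Zero-dimensional subschemes and scheme-theoretic images -/

/-- A zero-dimensional closed subscheme of a proper complex scheme is finite and discrete. -/
lemma finite_and_discreteTopology (s : Z ⟶ SpecC) [IsProper s] (hZ : topologicalKrullDim Z = 0) :
    Finite Z ∧ DiscreteTopology Z := by
  have := LocallyOfFiniteType.isLocallyNoetherian s
  have := IsLocallyArtinian.of_topologicalKrullDim_le_zero hZ.le
  have : CompactSpace Z := QuasiCompact.compactSpace_of_compactSpace s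
  have : IsArtinianScheme Z := {}
  exact ⟨inferInstance, inferInstance⟩

/-- Injectivity is known over the preimages of affine open sets of `X`; these cover the image, so
separatedness of the structure sheaf gives the global case. -/
lemma toImage_appTop_injective (f : Z ⟶ X) [QuasiCompact f] :
    Function.Injective f.toImage.appTop := by
  rw [injective_iff_map_eq_zero]
  intro a ha
  refine f.image.IsSheaf.section_ext fun x _ ↦ ?_
  obtain ⟨U, hU, hxU, -⟩ := exists_isAffineOpen_mem_and_subset (Opens.mem_top (f.imageι x))
  refine ⟨f.imageι ⁻¹ᵁ U, le_top, hxU, f.toImage_app_injective ⟨U, hU⟩ ?_⟩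
  have := congr($(f.toImage.naturality (homOfLE (le_top : f.imageι ⁻¹ᵁ U ≤ ⊤)).op) a)
  refine this.trans ?_
  rw [map_zero, map_zero]
  exact congr(Z.presheaf.map _ $ha).trans (map_zero (Z.presheaf.map _).hom)

/-- The scheme-theoretic image of a finite discrete scheme is finite and discrete. -/
lemma finite_and_discreteTopology_image [Finite Z] [DiscreteTopology Z] (s : X ⟶ SpecC) [IsProper s]
    (f : Z ⟶ X) [IsProper (f ≫ s)] : Finite f.image ∧ DiscreteTopology f.image := by
  have : IsProper f := .of_comp f s
  have : IsProper (f.toImage ≫ f.imageι) := by rwa [f.toImage_imageι]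
  have : IsProper f.toImage := .of_comp _ f.imageι
  -- The map to the image is dominant, and closed because it is proper.
  have hsurj : Function.Surjective f.toImage := by
    rw [← Set.range_eq_univ, ← f.toImage.isClosedMap.isClosed_range.closure_eq]
    exact f.toImage.denseRange.closure_eq
  have : Finite f.image := Finite.of_surjective _ hsurj
  have : T1Space f.image := ⟨fun x ↦ by
    obtain ⟨z, rfl⟩ := hsurj x
    simpa using f.toImage.isClosedMap {z} (isClosed_discrete _)⟩
  exact ⟨inferInstance, inferInstance⟩

/-- Additive spans of products in a tensor product. -/
lemma mem_closure_mul_of_closure_eq_top {A B C : Type*} [CommRing A] [CommRing B] [CommRing C]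
    (f : A →+* C) (g : B →+* C) (h : Subring.closure (Set.range f ∪ Set.range g) = ⊤)
    (I : AddSubgroup C) (hI : ∀ a b, f a * g b ∈ I) : I = ⊤ := by
  rw [eq_top_iff]
  intro x _
  have hx : x ∈ Subring.closure (Set.range f ∪ Set.range g) := h ▸ trivial
  rw [Subring.mem_closure_iff] at hx
  refine (AddSubgroup.closure_le I).mpr ?_ hx
  intro y hy
  have hy : y ∈ Submonoid.closure (Set.range f ∪ Set.range g) := hy
  have h1 := MonoidHom.coe_mrange (f : A →* C)
  have h2 := MonoidHom.coe_mrange (g : B →* C)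
  -- By commutativity, a word in the two ranges collapses to a single product `f a * g b`, and the
  -- subring is the additive span of such words.
  rw [Submonoid.closure_union] at hy
  obtain ⟨y, hy', z, hz', rfl⟩ := Submonoid.mem_sup.mp hy
  have hy := (Submonoid.closure_le (S := MonoidHom.mrange (f : A →* C))).mpr (by rw [h1]; rfl) hy'
  have hz := (Submonoid.closure_le (S := MonoidHom.mrange (g : B →* C))).mpr (by rw [h2]; rfl) hz'
  obtain ⟨a, rfl⟩ := hy
  obtain ⟨b, rfl⟩ := hz
  exact hI a b

/-- `Proj` is proper over the spectrum of the degree-zero part, and that part consists of constants,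
so the remaining map to `Spec ℂ` is a closed immersion. -/
lemma isProper_of_isProjective {s : X ⟶ SpecC} (hs : IsProjective s) : IsProper s := by
  obtain ⟨n, j, hj, rfl⟩ := hs
  have : IsProper (projSpaceToSpec n) := by
    have hsurj : Function.Surjective
        (algebraMap ℂ (MvPolynomial.homogeneousSubmodule (Fin (n + 1)) ℂ 0)) := by
      rintro ⟨p, hp⟩
      rw [MvPolynomial.homogeneousSubmodule_zero, Submodule.mem_one] at hp
      obtain ⟨c, rfl⟩ := hp
      exact ⟨c, rfl⟩
    have := IsClosedImmersion.spec_of_surjective (CommRingCat.ofHom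
      (algebraMap ℂ (MvPolynomial.homogeneousSubmodule (Fin (n + 1)) ℂ 0))) hsurj
    have : Algebra.FiniteType (MvPolynomial.homogeneousSubmodule (Fin (n + 1)) ℂ 0)
        (MvPolynomial (Fin (n + 1)) ℂ) := by
      have : IsScalarTower ℂ (MvPolynomial.homogeneousSubmodule (Fin (n + 1)) ℂ 0) 
          (MvPolynomial (Fin (n + 1)) ℂ) :=
        ⟨fun c a p ↦ smul_mul_assoc c (a : MvPolynomial (Fin (n + 1)) ℂ) p⟩
      exact Algebra.FiniteType.of_restrictScalars_finiteType ℂ _ _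
    unfold projSpaceToSpec
    infer_instance
  infer_instance

/-- Sections of a sufficiently very ample sheaf generate its restriction to the scheme-theoretic
image of a finite scheme. -/
lemma IsVeryAmpleOfOrder.exists_generator_image {s : X ⟶ SpecC} [IsProper s] {L : X.Modules}
    (hL : HasLocalGenerators L) {k : ℕ} (hk : IsVeryAmpleOfOrder s k L) [Finite Z]
    [DiscreteTopology Z] (f : Z ⟶ X) [IsProper (f ≫ s)] (hfin : (scalars (f ≫ s)).Finite)
    (hle : hZero (f ≫ s) ≤ k + 1) :
    ∃ t : Γ(L, ⊤), IsGenerator (pull f.imageι L) ⊤ (gsec f.imageι L t) ∧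
      ∀ a : Γ(f.image, ⊤), ∃ r : Γ(L, ⊤), gsec f.imageι L r = a • gsec f.imageι L t := by
  obtain ⟨h1, h2⟩ := finite_and_discreteTopology_image s f
  have : IsProper f := .of_comp f s
  have hcomp : scalars (f ≫ s) = f.toImage.appTop.hom.comp (scalars (f.imageι ≫ s)) := by
    rw [← scalars_comp, f.toImage_imageι_assoc]
  obtain ⟨h3, h4⟩ := finite_and_complexDim_le _ (toImage_appTop_injective f) hcomp hfin
  have h5 : hZero (f.imageι ≫ s) ≤ k + 1 := h4.trans hle
  -- The difference is the number of points missing from length `k + 1`; `h5` keeps the truncated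
  -- subtraction honest.
  have hsurj := hk.restrictionMap_surjective hL (k + 1 - hZero (f.imageι ≫ s)) f.image f.imageι h3
    (by omega)
  obtain ⟨e, he⟩ := (hL.pull f.imageι).exists_global
  obtain ⟨t, rfl⟩ := hsurj e
  exact ⟨t, he, fun a ↦ hsurj (a • gsec f.imageι L t)⟩

/-! ### The external tensor product is very ample -/

/-- Lifting a section along a factorization through a closed subscheme. -/
lemma gsec_gsec_eq_smul {f : Z ⟶ Y} {p : Y ⟶ X} {g : Z ⟶ W} {j : W ⟶ X} (h : f ≫ p = g ≫ j)
    (L : X.Modules) {r t : Γ(L, ⊤)} {a : Γ(W, ⊤)} (hr : gsec j L r = a • gsec j L t) :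
    gsec f _ (gsec p L r) = g.appTop a • gsec f _ (gsec p L t) := by
  obtain ⟨φ, hφ, H⟩ := exists_iso_of_comm h L
  apply (app_bijective φ ⊤).1
  rw [H, hr, gsec_smul, Scheme.Modules.Hom.app_smul, H]

lemma isGenerator_gsec_gsec {f : Z ⟶ Y} {p : Y ⟶ X} {g : Z ⟶ W} {j : W ⟶ X} (h : f ≫ p = g ≫ j)
    (L : X.Modules) {t : Γ(L, ⊤)} (ht : IsGenerator (pull j L) ⊤ (gsec j L t)) :
    IsGenerator (pull f (pull p L)) ⊤ (gsec f _ (gsec p L t)) := by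
  obtain ⟨φ, hφ, H⟩ := exists_iso_of_comm h L
  apply IsGenerator.of_map φ
  rw [H]
  exact ht.sec g

open Limits in
/-- Functions on a closed subscheme of a product of affine schemes are generated by functions
from the factors. -/
lemma closure_range_union_range_eq_top {W₁ W₂ : Scheme.{0}} [IsAffine W₁] [IsAffine W₂]
    (w₁ : W₁ ⟶ SpecC) (w₂ : W₂ ⟶ SpecC) (h : Z ⟶ pullback w₁ w₂) [IsClosedImmersion h] :
    Subring.closure (Set.range (h ≫ pullback.fst w₁ w₂).appTop.hom ∪
      Set.range (h ≫ pullback.snd w₁ w₂).appTop.hom) = ⊤ := by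
  have h1 := CommRingCat.closure_range_union_range_eq_top_of_isPushout
    (isPushout_appTop_of_isPullback (IsPullback.of_hasPullback w₁ w₂))
  have h2 := (IsClosedImmersion.isAffine_surjective_of_isAffine h).2
  have h3 := congr(Subring.map h.appTop.hom $h1)
  rw [RingHom.map_closure, Set.image_union, ← Set.range_comp, ← Set.range_comp,
    ← RingHom.range_eq_map, RingHom.range_eq_top.mpr h2] at h3
  simpa only [Scheme.Hom.comp_appTop, CommRingCat.hom_comp, RingHom.coe_comp] using h3

-- The closed immersion `f` factors through the product of the two images followed by the separated
-- map `m`, so its first factor is a closed immersion as well.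
open Limits in
lemma isClosedImmersion_lift_toImage {X₁ X₂ : Scheme.{0}} (s₁ : X₁ ⟶ SpecC) (s₂ : X₂ ⟶ SpecC)
    [IsSeparated s₂] (f : Z ⟶ pullback s₁ s₂) [IsClosedImmersion f] (f₁ : Z ⟶ X₁) (f₂ : Z ⟶ X₂)
    (h₁ : f ≫ pullback.fst s₁ s₂ = f₁) (h₂ : f ≫ pullback.snd s₁ s₂ = f₂)
    (w : f₁.toImage ≫ f₁.imageι ≫ s₁ = f₂.toImage ≫ f₂.imageι ≫ s₂) :
    IsClosedImmersion (pullback.lift f₁.toImage f₂.toImage w) := by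
  let m : pullback (f₁.imageι ≫ s₁) (f₂.imageι ≫ s₂) ⟶ pullback s₁ s₂ :=
    pullback.lift (pullback.fst _ _ ≫ f₁.imageι) (pullback.snd _ _ ≫ f₂.imageι)
      (by rw [Category.assoc, Category.assoc, pullback.condition])
  have hm₁ : m ≫ pullback.fst s₁ s₂ = pullback.fst _ _ ≫ f₁.imageι := pullback.lift_fst _ _ _
  have hm₂ : m ≫ pullback.snd s₁ s₂ = pullback.snd _ _ ≫ f₂.imageι := pullback.lift_snd _ _ _
  have hm : IsSeparated m := by
    have : IsSeparated (m ≫ pullback.fst s₁ s₂) := by rw [hm₁]; infer_instance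
    exact .of_comp m (pullback.fst s₁ s₂)
  have hf : pullback.lift f₁.toImage f₂.toImage w ≫ m = f := by
    apply pullback.hom_ext
    · rw [Category.assoc, hm₁, pullback.lift_fst_assoc, f₁.toImage_imageι, h₁]
    · rw [Category.assoc, hm₂, pullback.lift_snd_assoc, f₂.toImage_imageι, h₂]
  have : IsClosedImmersion (pullback.lift f₁.toImage f₂.toImage w ≫ m) := by rwa [hf]
  exact .of_comp _ m

open Limits in
theorem isVeryAmpleOfOrder_boxTensor {X₁ X₂ : Scheme.{0}} (s₁ : X₁ ⟶ SpecC) (s₂ : X₂ ⟶ SpecC)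
    [IsProper s₁] [IsProper s₂] {L₁ : X₁.Modules} {L₂ : X₂.Modules} (hL₁ : HasLocalGenerators L₁)
    (hL₂ : HasLocalGenerators L₂) {k₁ k₂ : ℕ} (hk₁ : IsVeryAmpleOfOrder s₁ k₁ L₁)
    (hk₂ : IsVeryAmpleOfOrder s₂ k₂ L₂) :
    IsVeryAmpleOfOrder (pullback.fst s₁ s₂ ≫ s₁) (min k₁ k₂) (boxTensor s₁ s₂ L₁ L₂) := by
  intro Z f hf hdim hlen
  obtain ⟨hZfin, hZdisc⟩ := finite_and_discreteTopology (f ≫ pullback.fst s₁ s₂ ≫ s₁) hdim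
  obtain ⟨f₁, h₁⟩ : ∃ f₁, f ≫ pullback.fst s₁ s₂ = f₁ := ⟨_, rfl⟩
  obtain ⟨f₂, h₂⟩ : ∃ f₂, f ≫ pullback.snd s₁ s₂ = f₂ := ⟨_, rfl⟩
  have e₁ : f ≫ pullback.fst s₁ s₂ ≫ s₁ = f₁ ≫ s₁ := by rw [← h₁, Category.assoc]
  have e₂ : f₁ ≫ s₁ = f₂ ≫ s₂ := by
    rw [← h₁, ← h₂, Category.assoc, Category.assoc, pullback.condition]
  have hp₁ : IsProper (f₁ ≫ s₁) := by rw [← e₁]; infer_instance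
  have hp₂ : IsProper (f₂ ≫ s₂) := by rwa [← e₂]
  have : IsProper f₁ := .of_comp f₁ s₁
  have : IsProper f₂ := .of_comp f₂ s₂
  rw [e₁] at hlen
  have hfin : (scalars (f₁ ≫ s₁)).Finite := finite_of_complexDim_pos (by
    rw [← hZero_eq]; omega)
  obtain ⟨t₁, ht₁, H₁⟩ := hk₁.exists_generator_image hL₁ f₁ hfin (by omega)
  obtain ⟨t₂, ht₂, H₂⟩ := hk₂.exists_generator_image hL₂ f₂ (e₂ ▸ hfin) (by rw [← e₂]; omega)
  have c₁ : f ≫ pullback.fst s₁ s₂ = f₁.toImage ≫ f₁.imageι := by rw [h₁, f₁.toImage_imageι]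
  have c₂ : f ≫ pullback.snd s₁ s₂ = f₂.toImage ≫ f₂.imageι := by rw [h₂, f₂.toImage_imageι]
  have hM₁ := hL₁.pull (pullback.fst s₁ s₂)
  have hM₂ := hL₂.pull (pullback.snd s₁ s₂)
  have hgen := isGenerator_sec_tmul hM₁ hM₂ f (isGenerator_gsec_gsec c₁ L₁ ht₁)
    (isGenerator_gsec_gsec c₂ L₂ ht₂)
  set e := gsec f (tensor _ _) (tmul _ _ (gsec (pullback.fst s₁ s₂) L₁ t₁)
    (gsec (pullback.snd s₁ s₂) L₂ t₂)) with he
  obtain ⟨_, _⟩ := finite_and_discreteTopology_image s₁ f₁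
  obtain ⟨_, _⟩ := finite_and_discreteTopology_image s₂ f₂
  have w : f₁.toImage ≫ f₁.imageι ≫ s₁ = f₂.toImage ≫ f₂.imageι ≫ s₂ := by
    rw [f₁.toImage_imageι_assoc, f₂.toImage_imageι_assoc, e₂]
  have := isClosedImmersion_lift_toImage s₁ s₂ f f₁ f₂ h₁ h₂ w
  have hspan := closure_range_union_range_eq_top _ _ (pullback.lift f₁.toImage f₂.toImage w)
  rw [pullback.lift_fst, pullback.lift_snd] at hspan
  -- The functions `a` for which `a • e` lifts. The lifts form only an additive group, so the
  -- density argument has to produce sums of products rather than an ideal.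
  let I : AddSubgroup Γ(Z, ⊤) :=
    (gsec f (boxTensor s₁ s₂ L₁ L₂)).range.comap
      (AddMonoidHom.mk' (fun a : Γ(Z, ⊤) ↦ a • e) fun a b ↦ add_smul a b e)
  have hI : I = ⊤ := mem_closure_mul_of_closure_eq_top _ _ hspan I fun a b ↦ by
    obtain ⟨r₁, hr₁⟩ := H₁ a
    obtain ⟨r₂, hr₂⟩ := H₂ b
    exact ⟨_, sec_tmul_of_smul hM₁ hM₂ f (gsec_gsec_eq_smul c₁ L₁ hr₁)
      (gsec_gsec_eq_smul c₂ L₂ hr₂)⟩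
  intro b
  obtain ⟨a, rfl⟩ := hgen.exists_smul b
  have ha : a ∈ I := hI ▸ trivial
  exact ha

/-! ### The converse, by restriction to a fibre -/

open Limits in
/-- The preimage of a neighbourhood of a rational point is a neighbourhood of the fibre. -/
lemma preimage_eq_top_of_comp_eq {s : X ⟶ SpecC} {σ : X ⟶ Y} {p : Y ⟶ W} {x : SpecC ⟶ W}
    (h : σ ≫ p = s ≫ x) {V : W.Opens} (hV : x (IsLocalRing.closedPoint ℂ) ∈ V) :
    σ ⁻¹ᵁ p ⁻¹ᵁ V = ⊤ := by
  have : Subsingleton SpecC := inferInstanceAs (Subsingleton (PrimeSpectrum ℂ))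
  rw [← Scheme.Hom.comp_preimage, h, Scheme.Hom.comp_preimage]
  have : x ⁻¹ᵁ V = ⊤ := by
    ext y
    rw [Subsingleton.elim y (IsLocalRing.closedPoint ℂ)]
    exact iff_of_true hV trivial
  rw [this]
  rfl

/-- A non-empty complex algebraic scheme has a rational point. -/
lemma exists_rational_point (s : X ⟶ SpecC) [IsProper s] [Nonempty X] :
    ∃ x : SpecC ⟶ X, x ≫ s = 𝟙 _ := by
  have : JacobsonSpace X := LocallyOfFiniteType.jacobsonSpace s
  obtain ⟨x, -, hx⟩ := nonempty_inter_closedPoints (X := X) Set.univ_nonempty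
    isOpen_univ.isLocallyClosed
  exact ⟨pointOfClosedPoint s x hx, pointOfClosedPoint_comp s x hx⟩

/-- A section of a separated morphism is a closed immersion, so a subscheme of `X` becomes one of
`Y`. Its length is unchanged because `σ` is a morphism over `Spec ℂ`. -/
lemma isVeryAmpleOfOrder_of_section {s : X ⟶ SpecC} {y : Y ⟶ SpecC} {L : X.Modules}
    {T : Y.Modules} {k : ℕ} (hk : IsVeryAmpleOfOrder y k T) (p : Y ⟶ X) [IsSeparated p]
    (hy : p ≫ s = y) (σ : X ⟶ Y) (hσ : σ ≫ p = 𝟙 X) (U : Y.Opens) (hU : σ ⁻¹ᵁ U = ⊤)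
    (e : Nonempty ((pull p L).restrict U.ι ≅ T.restrict U.ι)) : IsVeryAmpleOfOrder s k L := by
  intro Z i hi hdim hlen
  have : IsClosedImmersion σ := by
    have : IsClosedImmersion (σ ≫ p) := by rw [hσ]; infer_instance
    exact .of_comp σ p
  refine restrictionMap_surjective_of_section U e.some σ hU p hσ rfl i
    (hk Z (i ≫ σ) inferInstance hdim ?_)
  rw [← hlen, ← hy, Category.assoc, reassoc_of% hσ]

open Limits in
theorem isVeryAmpleOfOrder_left {X₁ X₂ : Scheme.{0}} (s₁ : X₁ ⟶ SpecC) (s₂ : X₂ ⟶ SpecC)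
    [IsProper s₂] [Nonempty X₂] {L₁ : X₁.Modules} {L₂ : X₂.Modules}
    (hL₁ : HasLocalGenerators L₁) (hL₂ : HasLocalGenerators L₂) {k : ℕ}
    (hk : IsVeryAmpleOfOrder (pullback.fst s₁ s₂ ≫ s₁) k (boxTensor s₁ s₂ L₁ L₂)) :
    IsVeryAmpleOfOrder s₁ k L₁ := by
  obtain ⟨x, hx⟩ := exists_rational_point s₂
  obtain ⟨V, hV, l, hl⟩ := hL₂ (x (IsLocalRing.closedPoint ℂ))
  -- The inclusion of the fibre `X₁ × {x}`; it lands in the preimage of `V`, where the second tensor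
  -- factor is generated by the pullback of `l`.
  let σ : X₁ ⟶ pullback s₁ s₂ := pullback.lift (𝟙 _) (s₁ ≫ x) (by simp [hx])
  exact isVeryAmpleOfOrder_of_section hk (pullback.fst s₁ s₂) rfl σ
    (pullback.lift_fst _ _ _) (pullback.snd s₁ s₂ ⁻¹ᵁ V)
    (preimage_eq_top_of_comp_eq (s := s₁) (pullback.lift_snd _ _ _) hV)
    (nonempty_restrict_iso_tensor_left (hL₁.pull _) (hl.sec _))

open Limits in
theorem isVeryAmpleOfOrder_right {X₁ X₂ : Scheme.{0}} (s₁ : X₁ ⟶ SpecC) (s₂ : X₂ ⟶ SpecC)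
    [IsProper s₁] [Nonempty X₁] {L₁ : X₁.Modules} {L₂ : X₂.Modules}
    (hL₁ : HasLocalGenerators L₁) (hL₂ : HasLocalGenerators L₂) {k : ℕ}
    (hk : IsVeryAmpleOfOrder (pullback.fst s₁ s₂ ≫ s₁) k (boxTensor s₁ s₂ L₁ L₂)) :
    IsVeryAmpleOfOrder s₂ k L₂ := by
  obtain ⟨x, hx⟩ := exists_rational_point s₁
  obtain ⟨V, hV, l, hl⟩ := hL₁ (x (IsLocalRing.closedPoint ℂ))
  let σ : X₂ ⟶ pullback s₁ s₂ := pullback.lift (s₂ ≫ x) (𝟙 _) (by simp [hx])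
  exact isVeryAmpleOfOrder_of_section hk (pullback.snd s₁ s₂) pullback.condition.symm σ
    (pullback.lift_snd _ _ _) (pullback.fst s₁ s₂ ⁻¹ᵁ V)
    (preimage_eq_top_of_comp_eq (s := s₂) (pullback.lift_fst _ _ _) hV)
    (nonempty_restrict_iso_tensor_right (hL₂.pull _) (hl.sec _))

end VeryAmpleness

end

theorem mainTheorem7 {X₁ X₂ : Scheme.{0}}
    (s₁ : X₁ ⟶ VeryAmpleness.SpecC) (s₂ : X₂ ⟶ VeryAmpleness.SpecC)
    (hX₁ : VeryAmpleness.IsProjective s₁) (hX₂ : VeryAmpleness.IsProjective s₂)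
    [Nonempty X₁] [Nonempty X₂]
    (L₁ : X₁.Modules) (L₂ : X₂.Modules)
    (hL₁ : VeryAmpleness.IsLineBundle L₁) (hL₂ : VeryAmpleness.IsLineBundle L₂) :
    (∀ k₁ k₂ : ℕ,
      VeryAmpleness.IsVeryAmpleOfOrder s₁ k₁ L₁ →
      VeryAmpleness.IsVeryAmpleOfOrder s₂ k₂ L₂ →
      VeryAmpleness.IsVeryAmpleOfOrder (Limits.pullback.fst s₁ s₂ ≫ s₁) (min k₁ k₂)
        (VeryAmpleness.boxTensor s₁ s₂ L₁ L₂)) ∧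
    (∀ k' : ℕ,
      VeryAmpleness.IsVeryAmpleOfOrder (Limits.pullback.fst s₁ s₂ ≫ s₁) k'
        (VeryAmpleness.boxTensor s₁ s₂ L₁ L₂) →
      VeryAmpleness.IsVeryAmpleOfOrder s₁ k' L₁ ∧
      VeryAmpleness.IsVeryAmpleOfOrder s₂ k' L₂) := by
  have := VeryAmpleness.isProper_of_isProjective hX₁
  have := VeryAmpleness.isProper_of_isProjective hX₂
  have h₁ := VeryAmpleness.HasLocalGenerators_of_isLineBundle hL₁
  have h₂ := VeryAmpleness.HasLocalGenerators_of_isLineBundle hL₂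
  exact ⟨fun _ _ ↦ VeryAmpleness.isVeryAmpleOfOrder_boxTensor s₁ s₂ h₁ h₂, fun _ hk ↦
    ⟨VeryAmpleness.isVeryAmpleOfOrder_left s₁ s₂ h₁ h₂ hk,
      VeryAmpleness.isVeryAmpleOfOrder_right s₁ s₂ h₁ h₂ hk⟩⟩
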